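/- **Lemma 9 (Extended Triangle Normal Lemma).** Let $2\le k<d$ and let $\Sigma\subset\mathbb{R}^d$ be a compact embedded $k$-dimensional submanifold without boundary, of class $C^2$ (for instance, $C^\infty$). The medial axis $M$ of $\Sigma$ is the closure of the set of centers of open balls that are disjoint from $\Sigma$ and whose boundary meets $\Sigma$ in more than one point, and $\mathrm{lfs}(p)=\min_{m\in M}|pm|$ for $p\in\Sigma$. For $p\in\Sigma$, $N_p\Sigma$ is the $(d-k)$-flat through $p$ orthogonal to the tangent space of $\Sigma$ at $p$. For a (nondegenerate) triangle $\tau$, $N_\tau$ is the $(d-2)$-flat of the points equidistant from its three vertices. For flats $F,G$ of positive dimension with $\dim F\le\dim G$, $\angle(F,G)=\angle(G,F)=\max_{\ell_F\subset F}\min_{\ell_G\subset G}\angle(\ell_F,\ell_G)\in[0^\circ,90^\circ]$, where $\ell_F,\ell_G$ are lines. Let $\tau$ be a triangle whose vertices lie on $\Sigma$, let $R$ be its circumradius, and suppose that $R\le\kappa\,\mathrm{lfs}(w)$ for each of the three vertices $w$ of $\tau$, for some $\kappa\le 1/2$. Let $x$ be any point of $\tau$ and let $\tilde x$ be a point of $\Sigma$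 nearest to $x$. Then for every angle $\phi\in(0^\circ,60^\circ]$, $$\angle(N_\tau,N_{\tilde x}\Sigma)\le\max\left\{\eta(\sqrt2\,\kappa)+\arcsin\left(\kappa\cot\frac{\phi}{2}\right),\ \eta(2\kappa)+\arcsin\left(\kappa\cot\left(45^\circ-\frac{\phi}{4}\right)\right)\right\},$$ where $\eta=\eta_1$ if $d-k=1$ and $\eta=\eta_2$ if $d-k\ge2$, with $$\eta_1(\delta)=\arccos\left(1-\frac{\delta^2}{2\sqrt{1-\delta^2}}\right),\qquad \eta_2(\delta)=\arccos\sqrt{1-\frac{\delta^2}{\sqrt{1-\delta^2}}}.$$ Where these formulas are undefined, we set $\eta_1(\delta)=180^\circ$ (argument of $\arccos$ below $-1$, or $\delta\ge1$), $\eta_2(\delta)=90^\circ$ (argument of the outer root negative, or $\delta\ge1$), and $\arcsin t=90^\circ$ for $t>1$; the inequality is then trivially true. -/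

import Mathlib

open scoped Real

noncomputable section

/-- `S ⊆ ℝᵈ` is an embedded `k`-dimensional submanifold without boundary, of class `C²`: near each
of its points, a `C²` diffeomorphism between open subsets of `ℝᵈ` straightens `S` to an open
piece of a `k`-dimensional linear subspace. -/
def IsSubmanifold {d : ℕ} (k : ℕ) (S : Set (EuclideanSpace ℝ (Fin d))) : Prop :=
  ∀ p ∈ S, ∃ Φ : OpenPartialHomeomorph (EuclideanSpace ℝ (Fin d)) (EuclideanSpace ℝ (Fin d)),
    ∃ V : Submodule ℝ (EuclideanSpace ℝ (Fin d)),
      p ∈ Φ.source ∧ ContDiffOn ℝ 2 Φ Φ.source ∧ ContDiffOn ℝ 2 Φ.symm Φ.target ∧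
      Module.finrank ℝ V = k ∧ Φ '' (Φ.source ∩ S) = Φ.target ∩ (V : Set _)

/-- The linear space of vectors tangent to `S` at `p`, spanned by the velocities at `p` of the
curves in `S` through `p`. (For a `C²` submanifold these velocities already form a linear space.
The curves need to be differentiable only at time `0`.) -/
def tangentDirection {d : ℕ} (S : Set (EuclideanSpace ℝ (Fin d)))
    (p : EuclideanSpace ℝ (Fin d)) : Submodule ℝ (EuclideanSpace ℝ (Fin d)) :=
  Submodule.span ℝ
    {v | ∃ γ : ℝ → EuclideanSpace ℝ (Fin d), (∀ t, γ t ∈ S) ∧ γ 0 = p ∧ HasDerivAt γ v 0}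

/-- The normal space of `S` at `p`: the flat through `p` that is the orthogonal complement of the
tangent space. -/
def normalSpace {d : ℕ} (S : Set (EuclideanSpace ℝ (Fin d)))
    (p : EuclideanSpace ℝ (Fin d)) : AffineSubspace ℝ (EuclideanSpace ℝ (Fin d)) :=
  AffineSubspace.mk' p (tangentDirection S p)ᗮ

/-- The normal space of a triangle: the flat of all points equidistant from its three vertices. -/
def triangleNormalSpace {d : ℕ} (τ : Affine.Triangle ℝ (EuclideanSpace ℝ (Fin d))) :
    AffineSubspace ℝ (EuclideanSpace ℝ (Fin d)) :=
  AffineSubspace.perpBisector (τ.points 0) (τ.points 1) ⊓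
    AffineSubspace.perpBisector (τ.points 0) (τ.points 2)

/-- The medial axis of `S`: the closure of the set of centers of the open balls that do not meet
`S` and whose boundary meets `S` in more than one point. -/
def medialAxis {d : ℕ} (S : Set (EuclideanSpace ℝ (Fin d))) : Set (EuclideanSpace ℝ (Fin d)) :=
  closure {c | ∃ r : ℝ, 0 < r ∧ Disjoint (Metric.ball c r) S ∧
    (Metric.sphere c r ∩ S).Nontrivial}

/-- The local feature size of `S` at `p`: the distance from `p` to the medial axis. -/
def lfs {d : ℕ} (S : Set (EuclideanSpace ℝ (Fin d))) (p : EuclideanSpace ℝ (Fin d)) : ℝ :=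
  Metric.infDist p (medialAxis S)

/-- The angle in `[0, π/2]` between the undirected lines spanned by two nonzero vectors. -/
def lineAngle {d : ℕ} (u v : EuclideanSpace ℝ (Fin d)) : ℝ :=
  min (InnerProductGeometry.angle u v) (π - InnerProductGeometry.angle u v)

/-- The maximum over the lines in the direction space `U` of the minimum over the lines in the
direction space `W` of the angle between the two lines. -/
def maxMinAngle {d : ℕ} (U W : Submodule ℝ (EuclideanSpace ℝ (Fin d))) : ℝ :=
  ⨆ u : {u : EuclideanSpace ℝ (Fin d) // u ∈ U ∧ u ≠ 0},
    ⨅ w : {w : EuclideanSpace ℝ (Fin d) // w ∈ W ∧ w ≠ 0}, lineAngle u.1 w.1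

/-- The angle between two flats: the maximum is over the lines of the flat of smaller dimension,
the minimum over those of the other one. -/
def flatAngle {d : ℕ} (F G : AffineSubspace ℝ (EuclideanSpace ℝ (Fin d))) : ℝ :=
  if Module.finrank ℝ F.direction ≤ Module.finrank ℝ G.direction then
    maxMinAngle F.direction G.direction
  else
    maxMinAngle G.direction F.direction

/-- The normal variation bound in codimension `1`. Where its formula stops making sense, because
the argument of the arccosine is below `-1` or `δ ≥ 1`, the value is `π`. -/
def eta₁ (δ : ℝ) : ℝ :=
  if δ < 1 then Real.arccos (1 - δ ^ 2 / (2 * √(1 - δ ^ 2))) else π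

/-- The normal variation bound in codimension `2` and higher. Where its formula stops making sense,
because the argument of the outer root is negative or `δ ≥ 1`, the value is `π / 2`. -/
def eta₂ (δ : ℝ) : ℝ :=
  if δ < 1 then Real.arccos √(1 - δ ^ 2 / √(1 - δ ^ 2)) else π / 2

/-- The normal variation bound for `k`-manifolds in `ℝᵈ`. -/
def eta (d k : ℕ) (δ : ℝ) : ℝ :=
  if d = k + 1 then eta₁ δ else eta₂ δ

end

/-! The normals of `S` at `y` (the nearest point to `x`) are compared with those of the triangle
through the normals at a well-chosen vertex `w`. A unit normal at `y` is within `eta` of some unit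
normal `m` at `w` (normal variation). In turn `m` is within `arcsin (κ cot (ψ/2))` of a vector
orthogonal to the plane of the triangle, where `ψ` is a lower bound for the angle at `w` (triangle
normal lemma).

Everything rests on `disjoint_ball_of_forall_notMem_medialAxis`: a ball touching `S` at `q` can
grow, keeping its point of contact, without meeting `S` while its center avoids the medial axis. For
the triangle normal lemma, balls of radius `lfs w` touching at `w` give `|⟪e, m⟫| ≤ |e|²/(2 lfs w)`
for the edges `e` at `w`. A Gram determinant and the laws of sines and cosines turn this into a
bound for the component of `m` in the plane.

For normal variation, a ball touching at `q` near `p` may grow until its center leaves the ball of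
radius `lfs p` around `p`. Two such balls on opposite sides, at infinitesimally close points, bound
the derivative of a normal field (`norm_sq_derivative_le`). Moving `q` towards `p` along the
tangential part of `p - q`, the decrease of `normalPotential` pays for the turning of the normal. No
flow is integrated: among the pairs (point, normal) whose turning is already paid for, one closest
to `p` exists by compactness, and it lies at `p`. This yields `eta₁` in every codimension, and `eta₁
≤ eta₂` as long as `eta₂` is below a right angle.

For the choice of `w`, let `i` be the vertex nearest to `x`. If its angle is at least `φ`, take `w =
i`; then `y` is within `√2 R` of `w`. Otherwise the larger of the other two angles is at least `90°
- φ/2`; at its vertex `y` is within `2R`. Bounds of at least `90°` are trivial, which disposes of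
large `κ`. -/

noncomputable section

open Metric InnerProductGeometry Filter Topology

/-! ### Maxima of the distance function over balls -/

section NearestPoint

variable {E : Type*} [NormedAddCommGroup E] [InnerProductSpace ℝ E]

/-- A point with a unique nearest point `y₀` in a compact set is not a local maximum of the distance
along a direction pointing away from `y₀`. -/
theorem exists_infDist_lt_of_inner_pos {S : Set E} (hS : IsCompact S) {z y₀ u : E}
    (hy₀ : y₀ ∈ S) (huniq : ∀ y ∈ S, dist z y = infDist z S → y = y₀)
    (hu : 0 < inner ℝ u (z - y₀)) :
    ∀ᶠ h : ℝ in 𝓝[>] 0, infDist z S < infDist (z + h • u) S := by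
  have hne : S.Nonempty := ⟨y₀, hy₀⟩
  -- By compactness, points of `S` that `u` does not point away from are farther from `z` than `y₀`
  -- by a definite gap `δ`. A nearest point of `z + h • u` cannot be among them once `h‖u‖ < δ`.
  obtain ⟨δ, hδ, hδK⟩ : ∃ δ > 0, ∀ y ∈ S, dist z y < infDist z S + δ → 0 < inner ℝ u (z - y) := by
    set K : Set E := S ∩ {y | inner ℝ u (z - y) ≤ 0} with hK
    have hKc : IsCompact K := hS.inter_right (isClosed_le (by fun_prop) (by fun_prop))
    rcases K.eq_empty_or_nonempty with hKe | hKne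
    · refine ⟨1, one_pos, fun y hy _ => ?_⟩
      by_contra hcon
      have : y ∈ K := ⟨hy, not_lt.1 hcon⟩
      simp [hKe] at this
    · obtain ⟨k, hk, hkd⟩ := hKc.exists_infDist_eq_dist hKne z
      have hlt : infDist z S < dist z k := by
        refine lt_of_le_of_ne (infDist_le_dist_of_mem hk.1) fun heq => ?_
        have := huniq k hk.1 heq.symm
        have h2 : inner ℝ u (z - k) ≤ 0 := hk.2
        rw [this] at h2
        linarith
      refine ⟨dist z k - infDist z S, by linarith, fun y hy hyd => ?_⟩
      by_contra hcon
      have : y ∈ K := ⟨hy, not_lt.1 hcon⟩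
      have := infDist_le_dist_of_mem (x := z) this
      linarith
  have hsmall : ∀ᶠ h : ℝ in 𝓝[>] 0, h * ‖u‖ < δ := by
    have : Tendsto (fun h : ℝ => h * ‖u‖) (𝓝[>] 0) (𝓝 (0 * ‖u‖)) :=
      ((continuous_id.mul continuous_const).tendsto 0).mono_left nhdsWithin_le_nhds
    rw [zero_mul] at this
    exact this.eventually_lt_const hδ
  filter_upwards [hsmall, self_mem_nhdsWithin] with h hh hpos
  have hpos : 0 < h := hpos
  by_contra hcon
  push Not at hcon
  obtain ⟨y, hy, hyd⟩ := hS.exists_infDist_eq_dist hne (z + h • u)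
  have h1 : dist z y ≤ dist z (z + h • u) + dist (z + h • u) y := dist_triangle _ _ _
  have h2 : dist z (z + h • u) = h * ‖u‖ := by
    simp [dist_eq_norm, norm_smul, abs_of_pos hpos]
  have h3 : 0 < inner ℝ u (z - y) := hδK y hy (by linarith)
  have h4 : infDist z S ≤ dist z y := infDist_le_dist_of_mem hy
  have h5 : dist (z + h • u) y ^ 2 = dist z y ^ 2 + 2 * h * inner ℝ u (z - y) + h ^ 2 * ‖u‖ ^ 2 := by
    rw [dist_eq_norm, dist_eq_norm, show z + h • u - y = (z - y) + h • u by abel,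
      norm_add_sq_real, inner_smul_right, norm_smul, real_inner_comm, mul_pow, Real.norm_eq_abs,
      sq_abs]
    ring
  have h6 : 0 < 2 * h * inner ℝ u (z - y) := by positivity
  have h7 : 0 ≤ infDist z S := infDist_nonneg
  have h8 : 0 ≤ h ^ 2 * ‖u‖ ^ 2 := by positivity
  have h9 : dist z y ^ 2 < dist (z + h • u) y ^ 2 := by linarith
  have h10 := lt_of_pow_lt_pow_left₀ 2 dist_nonneg h9
  linarith

/-- At a maximum `z` of the distance to `S` over a closed ball, the outer normal of the ball points
away from the nearest point of `z`. -/
theorem normalized_eq_of_isMaxOn_infDist {S : Set E} (hS : IsCompact S) {c z y₀ : E} {ε : ℝ}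
    (hε : 0 < ε) (hz : z ∈ closedBall c ε)
    (hmax : ∀ w ∈ closedBall c ε, infDist w S ≤ infDist z S)
    (hy₀ : y₀ ∈ S) (hne : z ≠ y₀) (huniq : ∀ y ∈ S, dist z y = infDist z S → y = y₀) :
    ε⁻¹ • (z - c) = ‖z - y₀‖⁻¹ • (z - y₀) := by
  have hB : 0 < ‖z - y₀‖ := norm_pos_iff.2 (sub_ne_zero.2 hne)
  have key : ∀ u : E, 0 < inner ℝ u (z - y₀) →
      ¬ ∀ᶠ h : ℝ in 𝓝[>] 0, z + h • u ∈ closedBall c ε := by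
    intro u hu hball
    obtain ⟨h, h1, h2⟩ := ((exists_infDist_lt_of_inner_pos hS hy₀ huniq hu).and hball).exists
    exact absurd (hmax _ h2) (not_le.2 h1)
  have hcont : ∀ u : E, Tendsto (fun h : ℝ => z + h • u) (𝓝[>] 0) (𝓝 z) := by
    intro u
    have : Tendsto (fun h : ℝ => z + h • u) (𝓝 0) (𝓝 (z + (0 : ℝ) • u)) :=
      (by fun_prop : Continuous fun h : ℝ => z + h • u).tendsto 0
    rw [zero_smul, add_zero] at this
    exact this.mono_left nhdsWithin_le_nhds
  have hnorm : ‖z - c‖ = ε := by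
    by_contra hcon
    have hlt : ‖z - c‖ < ε := lt_of_le_of_ne (by simpa [dist_eq_norm] using hz) hcon
    refine key (z - y₀) (by rw [real_inner_self_eq_norm_sq]; positivity) ?_
    have := (hcont (z - y₀)).eventually (isOpen_ball.mem_nhds (show z ∈ ball c ε by
      simpa [dist_eq_norm] using hlt))
    filter_upwards [this] with h hh using ball_subset_closedBall hh
  by_contra hcon
  set A := ε⁻¹ • (z - c) with hA
  set B := ‖z - y₀‖⁻¹ • (z - y₀) with hBdef
  have hA1 : ‖A‖ = 1 := by
    rw [hA, norm_smul, hnorm, norm_inv, Real.norm_eq_abs, abs_of_pos hε, inv_mul_cancel₀ hε.ne']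
  have hB1 : ‖B‖ = 1 := by
    rw [hBdef, norm_smul, norm_inv, norm_norm, inv_mul_cancel₀ hB.ne']
  have hlt : inner ℝ A B < 1 := (inner_lt_one_iff_real_of_norm_eq_one hA1 hB1).2 hcon
  have hzc : z - c = ε • A := by rw [hA, smul_smul, mul_inv_cancel₀ hε.ne', one_smul]
  have hzy : z - y₀ = ‖z - y₀‖ • B := by
    rw [hBdef, smul_smul, mul_inv_cancel₀ hB.ne', one_smul]
  -- If the unit vectors `A` and `B` differ, then `B - A` points strictly into the ball and still
  -- away from `y₀`, so following it contradicts maximality.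
  refine key (B - A) ?_ ?_
  · rw [hzy, inner_smul_right, inner_sub_left, real_inner_self_eq_norm_sq, hB1]
    have : 0 < 1 ^ 2 - inner ℝ A B := by linarith
    positivity
  · have hneg : inner ℝ (z - c) (B - A) < 0 := by
      rw [hzc, inner_smul_left, inner_sub_right, real_inner_self_eq_norm_sq, hA1]
      have : inner ℝ A B - 1 ^ 2 < 0 := by linarith
      exact mul_neg_of_pos_of_neg (by simpa using hε) this
    have hlim : Tendsto (fun h : ℝ => 2 * inner ℝ (z - c) (B - A) + h * ‖B - A‖ ^ 2) (𝓝[>] 0)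
        (𝓝 (2 * inner ℝ (z - c) (B - A) + 0 * ‖B - A‖ ^ 2)) :=
      ((by fun_prop : Continuous fun h : ℝ =>
        2 * inner ℝ (z - c) (B - A) + h * ‖B - A‖ ^ 2).tendsto 0).mono_left nhdsWithin_le_nhds
    have hev := hlim.eventually_lt_const (u := 0) (by linarith)
    filter_upwards [hev, self_mem_nhdsWithin] with h hh hpos
    have hpos : 0 < h := hpos
    rw [mem_closedBall, dist_eq_norm]
    refine abs_le_of_sq_le_sq' ?_ hε.le |>.2
    rw [show z + h • (B - A) - c = (z - c) + h • (B - A) by abel, norm_add_sq_real,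
      inner_smul_right, norm_smul, hnorm, mul_pow, Real.norm_eq_abs, sq_abs]
    nlinarith

end NearestPoint

/-! ### Growing tangent balls off the medial axis -/

section MedialAxis

variable {d : ℕ} {S : Set (EuclideanSpace ℝ (Fin d))}

/-- Points off the closed set `S` and off its medial axis have a unique nearest point. -/
theorem eq_of_dist_eq_infDist {z y y' : EuclideanSpace ℝ (Fin d)} (hz : 0 < infDist z S)
    (hz' : ¬ ∃ r : ℝ, 0 < r ∧ Disjoint (ball z r) S ∧ (sphere z r ∩ S).Nontrivial)
    (hy : y ∈ S) (hy' : y' ∈ S) (h : dist z y = infDist z S) (h' : dist z y' = infDist z S) :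
    y = y' := by
  by_contra hne
  refine hz' ⟨infDist z S, hz, ?_, y, ⟨?_, hy⟩, y', ⟨?_, hy'⟩, hne⟩
  · exact disjoint_ball_infDist
  · rw [mem_sphere, dist_comm, h]
  · rw [mem_sphere, dist_comm, h']

theorem disjoint_ball_iff_forall_le {c : EuclideanSpace ℝ (Fin d)} {r : ℝ} :
    Disjoint (ball c r) S ↔ ∀ z ∈ S, r ≤ dist z c := by
  rw [Set.disjoint_right]
  simp [mem_ball]

/-- A ball disjoint from `S` and tangent to `S` at `q` can be blown up as long as its center does not
meet the medial axis. -/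
theorem disjoint_ball_of_forall_notMem_medialAxis (hS : IsCompact S)
    {q n : EuclideanSpace ℝ (Fin d)} (hq : q ∈ S) (hn : ‖n‖ = 1) {t₀ t : ℝ} (ht₀ : 0 < t₀)
    (h₀t : t₀ ≤ t) (h₀ : Disjoint (ball (q + t₀ • n) t₀) S)
    (hM : ∀ τ, t₀ ≤ τ → τ < t → q + τ • n ∉ medialAxis S) :
    Disjoint (ball (q + t • n) t) S := by
  have hne : S.Nonempty := ⟨q, hq⟩
  set A : Set ℝ := {τ | τ ∈ Set.Icc t₀ t ∧ ∀ z ∈ S, τ ≤ dist z (q + τ • n)} with hA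
  have hAc : IsCompact A := by
    have : A = Set.Icc t₀ t ∩ ⋂ z ∈ S, {τ | τ ≤ dist z (q + τ • n)} := by
      ext τ; simp [hA]
    rw [this]
    refine isCompact_Icc.inter_right (isClosed_biInter fun z _ => ?_)
    exact isClosed_le continuous_id (by fun_prop)
  have hAne : A.Nonempty := ⟨t₀, ⟨le_rfl, h₀t⟩, disjoint_ball_iff_forall_le.1 h₀⟩
  set T := sSup A with hT
  have hTA : T ∈ A := hAc.sSup_mem hAne
  have hTmax : ∀ τ ∈ A, τ ≤ T := fun τ hτ => le_csSup hAc.bddAbove hτ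
  rcases hTA.1.2.eq_or_lt with hTt | hTt
  · rw [disjoint_ball_iff_forall_le, ← hTt]; exact hTA.2
  exfalso
  have hTpos : 0 < T := ht₀.trans_le hTA.1.1
  set c := q + T • n with hc
  have hcM := hM T hTA.1.1 hTt
  rw [medialAxis, ← Set.mem_compl_iff, ← interior_compl, mem_interior_iff_mem_nhds,
    Metric.mem_nhds_iff] at hcM
  obtain ⟨ε₀, hε₀, hball⟩ := hcM
  -- `ε₀` keeps the small ball off the medial axis, `T` makes `D - ε` below nonnegative, and `t - T`
  -- keeps the enlarged radius `T + ε` admissible.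
  set ε := min (ε₀ / 2) (min T (t - T)) with hεdef
  have hε : 0 < ε := lt_min (by linarith) (lt_min hTpos (by linarith))
  have hε₁ : ε < ε₀ := (min_le_left _ _).trans_lt (by linarith)
  have hεT : ε ≤ T := (min_le_right _ _).trans (min_le_left _ _)
  have hεt : ε ≤ t - T := (min_le_right _ _).trans (min_le_right _ _)
  have hcq : dist c q = T := by
    simp [hc, dist_eq_norm, norm_smul, hn, abs_of_pos hTpos]
  have hcd : infDist c S = T := by
    refine le_antisymm ((infDist_le_dist_of_mem hq).trans hcq.le) ?_
    exact (le_infDist hne).2 fun {z} hz => by rw [dist_comm]; exact hTA.2 z hz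
  -- Maximizing over a small ball replaces differentiability of the distance function: at the
  -- maximum, `c`, `z` and the nearest point `y₀` of `z` are collinear.
  obtain ⟨z, hz, hmax⟩ := (isCompact_closedBall c ε).exists_isMaxOn
    ⟨c, mem_closedBall_self hε.le⟩ (continuous_infDist_pt S).continuousOn
  have hmax' : ∀ w ∈ closedBall c ε, infDist w S ≤ infDist z S := fun w hw => hmax hw
  have hzT : T ≤ infDist z S := hcd ▸ hmax' c (mem_closedBall_self hε.le)
  have hzpos : 0 < infDist z S := hTpos.trans_le hzT
  obtain ⟨y₀, hy₀, hy₀d⟩ := hS.exists_infDist_eq_dist hne z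
  have hzM := hball (closedBall_subset_ball hε₁ hz)
  have huniq : ∀ y ∈ S, dist z y = infDist z S → y = y₀ := fun y hy hyd =>
    eq_of_dist_eq_infDist hzpos hzM hy hy₀ hyd hy₀d.symm
  have hzy : z ≠ y₀ := by
    intro h
    rw [h, dist_self] at hy₀d
    rw [h] at hzpos
    linarith
  have hkkt := normalized_eq_of_isMaxOn_infDist hS hε hz hmax' hy₀ hzy huniq
  set D := ‖z - y₀‖ with hD
  have hDi : infDist z S = D := by rw [hy₀d, dist_eq_norm]
  have hDpos : 0 < D := hDi ▸ hzpos
  set b := D⁻¹ • (z - y₀) with hb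
  have hb1 : ‖b‖ = 1 := by
    rw [hb, norm_smul, norm_inv, Real.norm_eq_abs, abs_of_pos hDpos, ← hD,
      inv_mul_cancel₀ hDpos.ne']
  have hzc : z = c + ε • b := by
    rw [← hkkt, smul_smul, mul_inv_cancel₀ hε.ne', one_smul]; abel
  have hzy' : z = y₀ + D • b := by
    rw [hb, smul_smul, mul_inv_cancel₀ hDpos.ne', one_smul]; abel
  have hcy : c - y₀ = (D - ε) • b := by
    have : c + ε • b = y₀ + D • b := by rw [← hzc, ← hzy']
    rw [sub_smul, eq_sub_iff_add_eq, sub_add_eq_add_sub, this]; abel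
  have hDle : D ≤ T + ε := by
    rw [← hDi, ← hcd]
    have := infDist_le_infDist_add_dist (s := S) (x := z) (y := c)
    have h2 : dist z c ≤ ε := hz
    linarith
  have hdcy : dist c y₀ = D - ε := by
    rw [dist_eq_norm, hcy, norm_smul, hb1, mul_one, Real.norm_eq_abs, abs_of_nonneg]
    linarith
  -- As the distance to `S` is 1-Lipschitz, `y₀` is also nearest to `c`, hence equal to `q`. So `z`
  -- is the center of a larger empty ball touching at `q`.
  have hcy₀ : dist c y₀ = infDist c S := by
    refine le_antisymm (by linarith) (infDist_le_dist_of_mem hy₀)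
  have hcM' := hball (mem_ball_self hε₀)
  have hyq : y₀ = q := eq_of_dist_eq_infDist (by linarith) hcM' hy₀ hq hcy₀ (by rw [hcq, hcd])
  have hDT : D = T + ε := by linarith
  have hbn : b = n := by
    have : T • n = T • b := by
      have h1 : c - y₀ = T • n := by rw [hyq, hc]; abel
      rw [← h1, hcy, hDT]; congr 1; ring
    exact (smul_right_injective _ hTpos.ne' this).symm
  have hmem : T + ε ∈ A := by
    refine ⟨⟨by linarith [hTA.1.1], by linarith⟩, fun w hw => ?_⟩
    have : q + (T + ε) • n = z := by rw [hzy', hyq, hDT, hbn]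
    rw [this, ← hDT, ← hDi, dist_comm]
    exact infDist_le_dist_of_mem hw
  linarith [hTmax _ hmem]

/-- Points closer to `p` than the local feature size of `p` are not on the medial axis. -/
theorem notMem_medialAxis_of_dist_lt {p z : EuclideanSpace ℝ (Fin d)} (h : dist p z < lfs S p) :
    z ∉ medialAxis S := fun hz => not_le.2 h (infDist_le_dist_of_mem hz)

end MedialAxis

/-! ### Tangent and normal spaces in a straightening chart -/

section Straightening

variable {d : ℕ}

/-- `Φ` straightens `S` to a piece of the linear subspace `V`. -/
structure IsStraightening (S : Set (EuclideanSpace ℝ (Fin d)))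
    (Φ : OpenPartialHomeomorph (EuclideanSpace ℝ (Fin d)) (EuclideanSpace ℝ (Fin d)))
    (V : Submodule ℝ (EuclideanSpace ℝ (Fin d))) : Prop where
  contDiffOn : ContDiffOn ℝ 2 Φ Φ.source
  contDiffOn_symm : ContDiffOn ℝ 2 Φ.symm Φ.target
  image_eq : Φ '' (Φ.source ∩ S) = Φ.target ∩ (V : Set _)

variable {S : Set (EuclideanSpace ℝ (Fin d))}
  {Φ : OpenPartialHomeomorph (EuclideanSpace ℝ (Fin d)) (EuclideanSpace ℝ (Fin d))}
  {V : Submodule ℝ (EuclideanSpace ℝ (Fin d))} {q v w n μ : EuclideanSpace ℝ (Fin d)}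

/-- The adjoint of `L` applied to `μ`, in coordinates. -/
def adjointApply (L : EuclideanSpace ℝ (Fin d) →L[ℝ] EuclideanSpace ℝ (Fin d))
    (μ : EuclideanSpace ℝ (Fin d)) : EuclideanSpace ℝ (Fin d) :=
  ∑ i, inner ℝ μ (L (EuclideanSpace.basisFun (Fin d) ℝ i)) • EuclideanSpace.basisFun (Fin d) ℝ i

theorem inner_adjointApply (L : EuclideanSpace ℝ (Fin d) →L[ℝ] EuclideanSpace ℝ (Fin d))
    (μ x : EuclideanSpace ℝ (Fin d)) : inner ℝ (adjointApply L μ) x = inner ℝ μ (L x) := by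
  conv_rhs => rw [← (EuclideanSpace.basisFun (Fin d) ℝ).sum_repr' x]
  simp only [adjointApply, sum_inner, inner_smul_left, map_sum, map_smul, inner_sum,
    inner_smul_right]
  refine Finset.sum_congr rfl fun i _ => ?_
  simp [mul_comm]

theorem adjointApply_sub (L : EuclideanSpace ℝ (Fin d) →L[ℝ] EuclideanSpace ℝ (Fin d))
    (μ ν : EuclideanSpace ℝ (Fin d)) :
    adjointApply L (μ - ν) = adjointApply L μ - adjointApply L ν := by
  refine ext_inner_right ℝ fun x => ?_
  simp only [inner_sub_left, inner_adjointApply]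

theorem adjointApply_smul (L : EuclideanSpace ℝ (Fin d) →L[ℝ] EuclideanSpace ℝ (Fin d)) (a : ℝ)
    (μ : EuclideanSpace ℝ (Fin d)) : adjointApply L (a • μ) = a • adjointApply L μ := by
  refine ext_inner_right ℝ fun x => ?_
  simp only [inner_smul_left, inner_adjointApply]

theorem adjointApply_adjointApply {L L' : EuclideanSpace ℝ (Fin d) →L[ℝ] EuclideanSpace ℝ (Fin d)}
    (h : ∀ x, L' (L x) = x) (μ : EuclideanSpace ℝ (Fin d)) :
    adjointApply L (adjointApply L' μ) = μ := by
  refine ext_inner_right ℝ fun x => ?_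
  simp only [inner_adjointApply, h]

theorem differentiableAt_adjointApply
    {L : ℝ → EuclideanSpace ℝ (Fin d) →L[ℝ] EuclideanSpace ℝ (Fin d)} {t : ℝ}
    (hL : DifferentiableAt ℝ L t) (μ : EuclideanSpace ℝ (Fin d)) :
    DifferentiableAt ℝ (fun s => adjointApply (L s) μ) t := by
  unfold adjointApply
  refine DifferentiableAt.fun_sum fun i _ => ?_
  refine DifferentiableAt.smul_const ?_ _
  exact (differentiableAt_const μ).inner ℝ (hL.clm_apply (differentiableAt_const _))

namespace IsStraightening

theorem contDiffAt (h : IsStraightening S Φ V) (hq : q ∈ Φ.source) : ContDiffAt ℝ 2 Φ q :=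
  h.contDiffOn.contDiffAt (Φ.open_source.mem_nhds hq)

theorem contDiffAt_symm (h : IsStraightening S Φ V) (hw : w ∈ Φ.target) :
    ContDiffAt ℝ 2 Φ.symm w :=
  h.contDiffOn_symm.contDiffAt (Φ.open_target.mem_nhds hw)

theorem hasFDerivAt (h : IsStraightening S Φ V) (hq : q ∈ Φ.source) :
    HasFDerivAt Φ (fderiv ℝ Φ q) q :=
  ((h.contDiffAt hq).differentiableAt (by norm_num)).hasFDerivAt

theorem hasFDerivAt_symm (h : IsStraightening S Φ V) (hw : w ∈ Φ.target) :
    HasFDerivAt Φ.symm (fderiv ℝ Φ.symm w) w :=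
  ((h.contDiffAt_symm hw).differentiableAt (by norm_num)).hasFDerivAt

theorem fderiv_symm_fderiv (h : IsStraightening S Φ V) (hq : q ∈ Φ.source)
    (x : EuclideanSpace ℝ (Fin d)) : fderiv ℝ Φ.symm (Φ q) (fderiv ℝ Φ q x) = x := by
  have h1 := (h.hasFDerivAt_symm (Φ.map_source hq)).comp q (h.hasFDerivAt hq)
  have h2 : HasFDerivAt (Φ.symm ∘ Φ) (ContinuousLinearMap.id ℝ _) q := by
    refine (hasFDerivAt_id q).congr_of_eventuallyEq ?_
    filter_upwards [Φ.open_source.mem_nhds hq] with y hy using Φ.left_inv hy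
  have := h1.unique h2
  exact congrArg (fun L => L x) this

theorem fderiv_fderiv_symm (h : IsStraightening S Φ V) (hw : w ∈ Φ.target)
    (x : EuclideanSpace ℝ (Fin d)) : fderiv ℝ Φ (Φ.symm w) (fderiv ℝ Φ.symm w x) = x := by
  have h1 := (h.hasFDerivAt (Φ.map_target hw)).comp w (h.hasFDerivAt_symm hw)
  have h2 : HasFDerivAt (Φ ∘ Φ.symm) (ContinuousLinearMap.id ℝ _) w := by
    refine (hasFDerivAt_id w).congr_of_eventuallyEq ?_
    filter_upwards [Φ.open_target.mem_nhds hw] with y hy using Φ.right_inv hy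
  have := h1.unique h2
  exact congrArg (fun L => L x) this

theorem mem_iff (h : IsStraightening S Φ V) (hq : q ∈ Φ.source) : q ∈ S ↔ Φ q ∈ V := by
  constructor
  · intro hqS
    have : Φ q ∈ Φ '' (Φ.source ∩ S) := ⟨q, ⟨hq, hqS⟩, rfl⟩
    rw [h.image_eq] at this
    exact this.2
  · intro hV
    have : Φ q ∈ Φ '' (Φ.source ∩ S) := by
      rw [h.image_eq]; exact ⟨Φ.map_source hq, hV⟩
    obtain ⟨y, ⟨hy, hyS⟩, hyq⟩ := this
    rwa [← Φ.injOn hy hq hyq]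

/-- The curve in `S` through `q` corresponding to a line in `V`. -/
theorem eventually_symm_line (h : IsStraightening S Φ V) (hq : q ∈ Φ.source) (hqS : q ∈ S)
    (hw : w ∈ V) : ∀ᶠ t : ℝ in 𝓝 0, Φ q + t • w ∈ Φ.target ∧ Φ.symm (Φ q + t • w) ∈ S ∧
      HasDerivAt (fun t : ℝ => Φ.symm (Φ q + t • w)) (fderiv ℝ Φ.symm (Φ q + t • w) w) t := by
  have hcont : Continuous fun t : ℝ => Φ q + t • w := by fun_prop
  have hev : ∀ᶠ t : ℝ in 𝓝 0, Φ q + t • w ∈ Φ.target :=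
    hcont.continuousAt.eventually (Φ.open_target.mem_nhds (by simpa using Φ.map_source hq))
  filter_upwards [hev] with t ht
  refine ⟨ht, ?_, ?_⟩
  · rw [h.mem_iff (Φ.map_target ht), Φ.right_inv ht]
    exact V.add_mem ((h.mem_iff hq).1 hqS) (V.smul_mem _ hw)
  · have h1 : HasDerivAt (fun t : ℝ => Φ q + t • w) w t := by
      simpa using ((hasDerivAt_id t).smul_const w).const_add (Φ q)
    exact (h.hasFDerivAt_symm ht).comp_hasDerivAt t h1

/-- The tangent space in a straightening chart. -/
theorem mem_tangentDirection_iff (h : IsStraightening S Φ V) (hq : q ∈ Φ.source) (hqS : q ∈ S) :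
    v ∈ tangentDirection S q ↔ fderiv ℝ Φ q v ∈ V := by
  constructor
  · have : tangentDirection S q ≤ V.comap (fderiv ℝ Φ q : _ →ₗ[ℝ] _) := by
      refine Submodule.span_le.2 ?_
      rintro v ⟨γ, hγS, rfl, hγ⟩
      -- Membership in `V` is tested against `Vᗮ`: the pairing of `μ ∈ Vᗮ` with the curve in the
      -- chart vanishes identically near `0`.
      rw [SetLike.mem_coe, Submodule.mem_comap, ← V.orthogonal_orthogonal,
        Submodule.mem_orthogonal]
      intro μ hμ
      have h1 : HasDerivAt (Φ ∘ γ) (fderiv ℝ Φ (γ 0) v) 0 :=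
        (h.hasFDerivAt hq).comp_hasDerivAt 0 hγ
      have h2 := (hasDerivAt_const (0 : ℝ) μ).inner ℝ h1
      have h3 : HasDerivAt (fun t => inner ℝ μ ((Φ ∘ γ) t)) 0 0 := by
        refine (hasDerivAt_const (0 : ℝ) (0 : ℝ)).congr_of_eventuallyEq ?_
        filter_upwards [hγ.continuousAt.eventually (Φ.open_source.mem_nhds hq)] with t ht
        exact Submodule.inner_left_of_mem_orthogonal ((h.mem_iff ht).1 (hγS t)) hμ
      simpa using h2.unique h3
    exact fun hv => this hv
  · intro hv
    refine Submodule.subset_span ?_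
    set w := fderiv ℝ Φ q v with hw
    classical
    have hev := h.eventually_symm_line hq hqS hv
    -- The curve must stay in `S` for all times, so it is replaced by the constant `q` where the
    -- chart gives no point of `S`; near `0` nothing changes.
    refine ⟨fun t => if Φ.symm (Φ q + t • w) ∈ S then Φ.symm (Φ q + t • w) else q, ?_, ?_, ?_⟩
    · intro t
      dsimp only
      split_ifs with ht
      · exact ht
      · exact hqS
    · simp [Φ.left_inv hq]
    · have h0 := hev.self_of_nhds.2.2
      simp only [zero_smul, add_zero] at h0
      rw [h.fderiv_symm_fderiv hq] at h0
      refine h0.congr_of_eventuallyEq ?_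
      filter_upwards [hev] with t ht
      rw [if_pos ht.2.1]

theorem fderiv_symm_mem (h : IsStraightening S Φ V) (hq : q ∈ Φ.source) (hqS : q ∈ S)
    (hw : w ∈ V) : fderiv ℝ Φ.symm (Φ q) w ∈ tangentDirection S q := by
  rw [h.mem_tangentDirection_iff hq hqS]
  have := h.fderiv_fderiv_symm (Φ.map_source hq) w
  rw [Φ.left_inv hq] at this
  rwa [this]

/-- Normals transform as covectors. Together with the converse `adjointApply_mem`, this parametrizes
the normal spaces at all points of the chart by the fixed space `Vᗮ`. -/
theorem adjointApply_symm_mem (h : IsStraightening S Φ V) (hq : q ∈ Φ.source) (hqS : q ∈ S)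
    (hn : n ∈ (tangentDirection S q)ᗮ) : adjointApply (fderiv ℝ Φ.symm (Φ q)) n ∈ Vᗮ := by
  rw [Submodule.mem_orthogonal']
  intro w hw
  rw [inner_adjointApply]
  exact Submodule.inner_left_of_mem_orthogonal (h.fderiv_symm_mem hq hqS hw) hn

theorem adjointApply_mem (h : IsStraightening S Φ V) (hq : q ∈ Φ.source) (hqS : q ∈ S)
    (hμ : μ ∈ Vᗮ) : adjointApply (fderiv ℝ Φ q) μ ∈ (tangentDirection S q)ᗮ := by
  rw [Submodule.mem_orthogonal']
  intro x hx
  rw [inner_adjointApply]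
  exact Submodule.inner_left_of_mem_orthogonal ((h.mem_tangentDirection_iff hq hqS).1 hx) hμ

theorem finrank_tangentDirection (h : IsStraightening S Φ V) (hq : q ∈ Φ.source) (hqS : q ∈ S) :
    Module.finrank ℝ (tangentDirection S q) = Module.finrank ℝ V := by
  let e : EuclideanSpace ℝ (Fin d) ≃ₗ[ℝ] EuclideanSpace ℝ (Fin d) :=
    LinearEquiv.ofLinearMap (fderiv ℝ Φ.symm (Φ q) : _ →ₗ[ℝ] _) (fderiv ℝ Φ q : _ →ₗ[ℝ] _)
      (LinearMap.ext fun x => h.fderiv_symm_fderiv hq x)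
      (LinearMap.ext fun x => by
        have := h.fderiv_fderiv_symm (Φ.map_source hq) x
        rw [Φ.left_inv hq] at this
        exact this)
  have : tangentDirection S q = V.map (e : _ →ₗ[ℝ] _) := by
    ext v
    rw [h.mem_tangentDirection_iff hq hqS, Submodule.mem_map]
    constructor
    · exact fun hv => ⟨_, hv, h.fderiv_symm_fderiv hq v⟩
    · rintro ⟨w, hw, rfl⟩
      exact (h.mem_tangentDirection_iff hq hqS).1 (h.fderiv_symm_mem hq hqS hw)
  rw [this]
  exact LinearEquiv.finrank_map_eq e V

/-- A `C²` submanifold deviates at most quadratically from its tangent spaces. -/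
theorem exists_inner_le_sq (h : IsStraightening S Φ V) (hq : q ∈ Φ.source) (hqS : q ∈ S)
    (hn : n ∈ (tangentDirection S q)ᗮ) :
    ∃ C > 0, ∃ r > 0, ∀ z ∈ S, dist z q < r → inner ℝ (z - q) n ≤ C * dist z q ^ 2 := by
  obtain ⟨K, s, hs, hK⟩ := ((h.contDiffAt hq).fderiv_right (m := 1) (by norm_num)).exists_lipschitzOnWith
  obtain ⟨r, hr, hball⟩ := Metric.mem_nhds_iff.1 (inter_mem hs (Φ.open_source.mem_nhds hq))
  set μ := adjointApply (fderiv ℝ Φ.symm (Φ q)) n with hμ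
  have hμV := h.adjointApply_symm_mem hq hqS hn
  refine ⟨‖μ‖ * K + 1, by positivity, r, hr, fun z hz hzr => ?_⟩
  have hqb : q ∈ closedBall q (dist z q) := mem_closedBall_self dist_nonneg
  have hsub : closedBall q (dist z q) ⊆ s ∩ Φ.source :=
    (closedBall_subset_ball hzr).trans hball
  have hmv := (convex_closedBall q (dist z q)).norm_image_sub_le_of_norm_hasFDerivWithin_le'
    (f := Φ) (f' := fun y => fderiv ℝ Φ y) (φ := fderiv ℝ Φ q) (C := K * dist z q)
    (fun y hy => (h.hasFDerivAt (hsub hy).2).hasFDerivWithinAt)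
    (fun y hy => by
      have := hK.dist_le_mul y (hsub hy).1 q (hsub hqb).1
      rw [← dist_eq_norm]
      exact this.trans (mul_le_mul_of_nonneg_left hy K.2)) hqb (mem_closedBall.2 le_rfl : z ∈ _)
  have hzs : z ∈ Φ.source := (hsub (mem_closedBall.2 le_rfl : z ∈ closedBall q (dist z q))).2
  have h1 : inner ℝ μ (Φ z - Φ q) = 0 :=
    Submodule.inner_left_of_mem_orthogonal
      (V.sub_mem ((h.mem_iff hzs).1 hz) ((h.mem_iff hq).1 hqS)) hμV
  have h2 : inner ℝ (z - q) n = inner ℝ μ (fderiv ℝ Φ q (z - q)) := by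
    rw [hμ, inner_adjointApply, h.fderiv_symm_fderiv hq, real_inner_comm]
  -- Both points map into `V`, so only the second-order Taylor remainder of `Φ` pairs with `μ`.
  have h3 : inner ℝ (z - q) n = - inner ℝ μ (Φ z - Φ q - fderiv ℝ Φ q (z - q)) := by
    rw [inner_sub_right, h1, h2]; ring
  have h4 := neg_le_of_abs_le (abs_real_inner_le_norm μ (Φ z - Φ q - fderiv ℝ Φ q (z - q)))
  rw [← dist_eq_norm z q] at hmv
  have h5 := mul_le_mul_of_nonneg_left hmv (norm_nonneg μ)
  nlinarith [sq_nonneg (dist z q)]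

end IsStraightening

end Straightening

/-! ### Normal bundle, small tangent balls, and normal fields along curves -/

section Submanifold

variable {d k : ℕ} {S : Set (EuclideanSpace ℝ (Fin d))} {q n v : EuclideanSpace ℝ (Fin d)}

theorem IsSubmanifold.exists_isStraightening (hS : IsSubmanifold k S) (hq : q ∈ S) :
    ∃ Φ, ∃ V : Submodule ℝ (EuclideanSpace ℝ (Fin d)),
      q ∈ Φ.source ∧ Module.finrank ℝ V = k ∧ IsStraightening S Φ V := by
  obtain ⟨Φ, V, h1, h2, h3, h4, h5⟩ := hS q hq
  exact ⟨Φ, V, h1, h4, h2, h3, h5⟩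

theorem IsSubmanifold.finrank_tangentDirection (hS : IsSubmanifold k S) (hq : q ∈ S) :
    Module.finrank ℝ (tangentDirection S q) = k := by
  obtain ⟨Φ, V, hqs, hV, h⟩ := hS.exists_isStraightening hq
  rw [h.finrank_tangentDirection hqs hq, hV]

/-- The normal bundle of a closed submanifold is closed. -/
theorem IsSubmanifold.isClosed_normalBundle (hS : IsSubmanifold k S) (hSc : IsClosed S) :
    IsClosed {x : EuclideanSpace ℝ (Fin d) × EuclideanSpace ℝ (Fin d) |
      x.1 ∈ S ∧ x.2 ∈ (tangentDirection S x.1)ᗮ} := by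
  refine isClosed_of_closure_subset ?_
  rintro ⟨q, n⟩ hx
  have hq : q ∈ S := by
    have := (hSc.preimage continuous_fst).closure_subset_iff.2
      (fun x (hx : x.1 ∈ S ∧ x.2 ∈ (tangentDirection S x.1)ᗮ) => hx.1) hx
    exact this
  refine ⟨hq, ?_⟩
  obtain ⟨Φ, V, hqs, -, h⟩ := hS.exists_isStraightening hq
  rw [Submodule.mem_orthogonal']
  intro v hv
  have hvV := (h.mem_tangentDirection_iff hqs hq).1 hv
  by_contra hne
  -- The chart extends the tangent vector `v` at `q` to tangent vectors at nearby points,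
  -- continuously; a nonzero pairing with `n` would persist there.
  have hcont : ContinuousAt (fun x : EuclideanSpace ℝ (Fin d) × EuclideanSpace ℝ (Fin d) =>
      inner ℝ x.2 (fderiv ℝ Φ.symm (Φ x.1) (fderiv ℝ Φ q v))) (q, n) := by
    have h1 : ContinuousAt (fun x : EuclideanSpace ℝ (Fin d) × EuclideanSpace ℝ (Fin d) => Φ x.1)
        (q, n) := ContinuousAt.comp (f := Prod.fst) (h.contDiffAt hqs).continuousAt continuousAt_fst
    have h2 : ContinuousAt (fun w => fderiv ℝ Φ.symm w) (Φ q) :=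
      ((h.contDiffAt_symm (Φ.map_source hqs)).fderiv_right (m := 1) (by norm_num)).continuousAt
    have h3 : ContinuousAt (fun x : EuclideanSpace ℝ (Fin d) × EuclideanSpace ℝ (Fin d) =>
        fderiv ℝ Φ.symm (Φ x.1)) (q, n) :=
      ContinuousAt.comp (f := fun x : EuclideanSpace ℝ (Fin d) × EuclideanSpace ℝ (Fin d) => Φ x.1)
        (g := fun w => fderiv ℝ Φ.symm w) h2 h1
    exact continuousAt_snd.inner (𝕜 := ℝ) (h3.clm_apply continuousAt_const)
  have hne' : inner ℝ n (fderiv ℝ Φ.symm (Φ q) (fderiv ℝ Φ q v)) ≠ 0 := by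
    rwa [h.fderiv_symm_fderiv hqs]
  have hev := hcont.eventually_ne hne'
  have hev2 : ∀ᶠ x in 𝓝 (q, n), x.1 ∈ Φ.source :=
    continuousAt_fst.eventually (Φ.open_source.mem_nhds hqs)
  obtain ⟨x, hxS, hx1, hx2⟩ := ((mem_closure_iff_frequently.1 hx).and_eventually
    (hev.and hev2)).exists
  exact hx1 (Submodule.inner_left_of_mem_orthogonal (h.fderiv_symm_mem hx2 hxS.1 hvV) hxS.2)

/-- Small balls tangent to a submanifold are disjoint from it. -/
theorem IsSubmanifold.exists_disjoint_ball (hS : IsSubmanifold k S) (hq : q ∈ S)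
    (hn : n ∈ (tangentDirection S q)ᗮ) (hn1 : ‖n‖ = 1) {t : ℝ} (ht : 0 < t) :
    ∃ t₀, 0 < t₀ ∧ t₀ ≤ t ∧ Disjoint (ball (q + t₀ • n) t₀) S := by
  obtain ⟨Φ, V, hqs, -, h⟩ := hS.exists_isStraightening hq
  obtain ⟨C, hC, r, hr, hle⟩ := h.exists_inner_le_sq hqs hq hn
  -- The bound `1 / (2C)` handles points of `S` near `q` by quadratic contact, and `r / 2` handles
  -- those at distance at least `r`.
  set t₀ := min t (min (r / 2) (1 / (2 * C))) with ht₀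
  have hpos : 0 < t₀ := lt_min ht (lt_min (by positivity) (by positivity))
  have h1 : t₀ ≤ r / 2 := (min_le_right _ _).trans (min_le_left _ _)
  have h2 : t₀ ≤ 1 / (2 * C) := (min_le_right _ _).trans (min_le_right _ _)
  refine ⟨t₀, hpos, min_le_left _ _, disjoint_ball_iff_forall_le.2 fun z hz => ?_⟩
  rcases lt_or_ge (dist z q) r with hzr | hzr
  · have h3 := hle z hz hzr
    have h4 : dist z (q + t₀ • n) ^ 2 = dist z q ^ 2 - 2 * t₀ * inner ℝ (z - q) n + t₀ ^ 2 := by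
      rw [dist_eq_norm, dist_eq_norm, ← sub_sub, norm_sub_sq_real, inner_smul_right, norm_smul, hn1,
        Real.norm_eq_abs, abs_of_pos hpos]
      ring
    have h5 : 2 * C * t₀ ≤ 1 := by
      have := mul_le_mul_of_nonneg_left h2 (by positivity : 0 ≤ 2 * C)
      rwa [mul_one_div_cancel (by positivity)] at this
    refine abs_le_of_sq_le_sq' (?_ : t₀ ^ 2 ≤ _) dist_nonneg |>.2
    rw [h4]
    nlinarith [sq_nonneg (dist z q), mul_le_mul_of_nonneg_left h3 hpos.le]
  · have h6 : dist (q + t₀ • n) q = t₀ := by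
      simp [dist_eq_norm, norm_smul, hn1, abs_of_pos hpos]
    have := dist_triangle z (q + t₀ • n) q
    linarith

/-- The curves through `q` in a submanifold, with a differentiable unit normal field along them whose
derivative at `q` is tangential. -/
theorem IsSubmanifold.exists_curve (hS : IsSubmanifold k S) (hq : q ∈ S)
    (hn : n ∈ (tangentDirection S q)ᗮ) (hn1 : ‖n‖ = 1) (hv : v ∈ tangentDirection S q) :
    ∃ τ ∈ tangentDirection S q, ∃ c c' ν : ℝ → EuclideanSpace ℝ (Fin d),
      c 0 = q ∧ c' 0 = v ∧ ν 0 = n ∧ ContinuousAt c' 0 ∧ HasDerivAt ν (-τ) 0 ∧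
      ∀ᶠ t in 𝓝 0, c t ∈ S ∧ ν t ∈ (tangentDirection S (c t))ᗮ ∧ ‖ν t‖ = 1 ∧
        HasDerivAt c (c' t) t ∧ c' t ∈ tangentDirection S (c t) := by
  obtain ⟨Φ, V, hqs, -, h⟩ := hS.exists_isStraightening hq
  set w := fderiv ℝ Φ q v with hw
  have hwV : w ∈ V := (h.mem_tangentDirection_iff hqs hq).1 hv
  have hqt := Φ.map_source hqs
  have hev := h.eventually_symm_line hqs hq hwV
  set c : ℝ → EuclideanSpace ℝ (Fin d) := fun t => Φ.symm (Φ q + t • w) with hc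
  set c' : ℝ → EuclideanSpace ℝ (Fin d) := fun t => fderiv ℝ Φ.symm (Φ q + t • w) w with hc'
  have hc0 : c 0 = q := by simp [hc, Φ.left_inv hqs]
  have hc'0 : c' 0 = v := by simp [hc', hw, h.fderiv_symm_fderiv hqs]
  have hc'cont : ContinuousAt c' 0 := by
    have h1 : ContinuousAt (fun t : ℝ => Φ q + t • w) 0 := by fun_prop
    have h2 : ContinuousAt (fun y => fderiv ℝ Φ.symm y) (Φ q + (0 : ℝ) • w) := by
      rw [zero_smul, add_zero]
      exact ((h.contDiffAt_symm hqt).fderiv_right (m := 1) (by norm_num)).continuousAt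
    exact (ContinuousAt.comp (f := fun t : ℝ => Φ q + t • w) (g := fun y => fderiv ℝ Φ.symm y)
      h2 h1).clm_apply continuousAt_const
  have hcd : HasDerivAt c v 0 := by
    have := hev.self_of_nhds.2.2
    rwa [← hc'0]
  have hLd : DifferentiableAt ℝ (fun t => fderiv ℝ Φ (c t)) 0 := by
    have h2 : DifferentiableAt ℝ (fun y => fderiv ℝ Φ y) (c 0) := by
      rw [hc0]
      exact ((h.contDiffAt hqs).fderiv_right (m := 1) (by norm_num)).differentiableAt (by norm_num)
    exact DifferentiableAt.comp (0 : ℝ) h2 hcd.differentiableAt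
  set T := tangentDirection S q with hT
  set μ := adjointApply (fderiv ℝ Φ.symm (Φ q)) n with hμ
  have hμV : μ ∈ Vᗮ := h.adjointApply_symm_mem hqs hq hn
  have hμn : adjointApply (fderiv ℝ Φ q) μ = n :=
    adjointApply_adjointApply (h.fderiv_symm_fderiv hqs) n
  set e := deriv (fun t => adjointApply (fderiv ℝ Φ (c t)) μ) 0 with he
  set eN := Tᗮ.starProjection e with heN
  have heNmem : eN ∈ Tᗮ := Submodule.starProjection_apply_mem _ _
  set μ' := adjointApply (fderiv ℝ Φ.symm (Φ q)) eN with hμ'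
  have hμ'V : μ' ∈ Vᗮ := h.adjointApply_symm_mem hqs hq heNmem
  have hμ'n : adjointApply (fderiv ℝ Φ q) μ' = eN :=
    adjointApply_adjointApply (h.fderiv_symm_fderiv hqs) eN
  -- The correction `-t • μ'` cancels the normal component `eN` of the derivative at `0`.
  -- Normalization then does not affect the derivative, as `n` is orthogonal to what is left.
  set N : ℝ → EuclideanSpace ℝ (Fin d) := fun t => adjointApply (fderiv ℝ Φ (c t)) (μ - t • μ')
    with hN
  have hN0 : N 0 = n := by simp [hN, hc0, hμn]
  have hNd : HasDerivAt N (e - eN) 0 := by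
    have h1 : HasDerivAt (fun t => adjointApply (fderiv ℝ Φ (c t)) μ) e 0 :=
      (differentiableAt_adjointApply hLd μ).hasDerivAt
    have h2 := (hasDerivAt_id (0 : ℝ)).smul (differentiableAt_adjointApply hLd μ').hasDerivAt
    have h3 := h1.sub h2
    simp only [id, zero_smul, zero_add, one_smul, hc0, hμ'n] at h3
    refine h3.congr_of_eventuallyEq (Eventually.of_forall fun t => ?_)
    simp [hN, adjointApply_sub, adjointApply_smul]
  have hperp : e - eN ∈ T := by
    have := Tᗮ.sub_starProjection_mem_orthogonal e
    rwa [Submodule.orthogonal_orthogonal] at this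
  have hnT : inner ℝ n (e - eN) = 0 := Submodule.inner_left_of_mem_orthogonal hperp hn
  have hnormd : HasDerivAt (fun t => ‖N t‖⁻¹) 0 0 := by
    have h1 := hNd.norm_sq
    rw [hN0, hnT] at h1
    have h2 := (h1.sqrt (by rw [hN0, hn1]; norm_num)).inv (by rw [hN0, hn1]; norm_num)
    simp only [mul_zero, zero_div, neg_zero] at h2
    refine h2.congr_of_eventuallyEq (Eventually.of_forall fun t => ?_)
    simp [Real.sqrt_sq (norm_nonneg _)]
  have hNne : ∀ᶠ t in 𝓝 0, N t ≠ 0 :=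
    hNd.continuousAt.eventually_ne (by rw [hN0]; intro h0; simp [h0] at hn1)
  refine ⟨-(e - eN), T.neg_mem hperp, c, c', fun t => ‖N t‖⁻¹ • N t, hc0, hc'0, ?_, hc'cont, ?_, ?_⟩
  · simp [hN0, hn1]
  · have := hnormd.smul hNd
    simp only [hN0, hn1, inv_one, one_smul, zero_smul, add_zero] at this
    rw [neg_neg]
    exact this
  · filter_upwards [hev, hNne] with t ht htN
    have hcs : c t ∈ Φ.source := Φ.map_target ht.1
    have hct : Φ (c t) = Φ q + t • w := Φ.right_inv ht.1
    refine ⟨ht.2.1, Submodule.smul_mem _ _ ?_, ?_, ht.2.2, ?_⟩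
    · exact h.adjointApply_mem hcs ht.2.1 (Submodule.sub_mem _ hμV (Submodule.smul_mem _ _ hμ'V))
    · rw [norm_smul, norm_inv, norm_norm, inv_mul_cancel₀ (norm_ne_zero_iff.2 htN)]
    · have := h.fderiv_symm_mem hcs ht.2.1 hwV
      rwa [hct] at this

end Submanifold

/-! ### Chords of the feature-size ball -/

section ExitLength

/-- The distance at which a ray starting at distance `s` from the center of a ball of radius `ℓ`
leaves that ball, where `a` is the component of the starting point along the ray. -/
def exitLength (ℓ s a : ℝ) : ℝ := -a + √(a ^ 2 + (ℓ ^ 2 - s ^ 2))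

variable {ℓ s a : ℝ}

theorem exitLength_pos (hs : s ^ 2 < ℓ ^ 2) : 0 < exitLength ℓ s a := by
  have : |a| < √(a ^ 2 + (ℓ ^ 2 - s ^ 2)) := Real.lt_sqrt_of_sq_lt (by rw [sq_abs]; linarith)
  have := le_abs_self a
  unfold exitLength
  linarith

/-- Power of a point: `exitLength ℓ s a + 2 * a` is the length of the other half of the chord. -/
theorem exitLength_mul_add (hs : s ^ 2 < ℓ ^ 2) :
    exitLength ℓ s a * (exitLength ℓ s a + 2 * a) = ℓ ^ 2 - s ^ 2 := by
  have := Real.sq_sqrt (show 0 ≤ a ^ 2 + (ℓ ^ 2 - s ^ 2) by nlinarith [sq_nonneg a])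
  unfold exitLength
  linear_combination this

theorem exitLength_neg : exitLength ℓ s (-a) = exitLength ℓ s a + 2 * a := by
  unfold exitLength
  rw [neg_sq]
  ring

end ExitLength

/-! ### Second-order estimates from tangent balls -/

section LocalEstimate

variable {d k : ℕ} {S : Set (EuclideanSpace ℝ (Fin d))} {p q n v τ : EuclideanSpace ℝ (Fin d)}

/-- Near `p`, balls tangent to `S` are disjoint from `S` as long as their centers are within the local
feature size of `p`. -/
theorem IsSubmanifold.exitLength_mul_inner_le (hS : IsSubmanifold k S) (hSc : IsCompact S)
    (hq : q ∈ S) (hqp : ‖q - p‖ < lfs S p) (hn : n ∈ (tangentDirection S q)ᗮ) (hn1 : ‖n‖ = 1)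
    {z : EuclideanSpace ℝ (Fin d)} (hz : z ∈ S) :
    2 * exitLength (lfs S p) ‖q - p‖ (inner ℝ (q - p) n) * inner ℝ (z - q) n ≤ ‖z - q‖ ^ 2 := by
  set ℓ := lfs S p
  set a := inner ℝ (q - p) n
  have hs : ‖q - p‖ ^ 2 < ℓ ^ 2 := pow_lt_pow_left₀ hqp (norm_nonneg _) two_ne_zero
  set t := exitLength ℓ ‖q - p‖ a
  have ht : 0 < t := exitLength_pos hs
  have hta : t * (t + 2 * a) = ℓ ^ 2 - ‖q - p‖ ^ 2 := exitLength_mul_add hs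
  obtain ⟨t₀, ht₀, ht₀t, hdisj⟩ := hS.exists_disjoint_ball hq hn hn1 ht
  have hball := disjoint_ball_of_forall_notMem_medialAxis hSc hq hn1 ht₀ ht₀t hdisj
    (fun σ hσ₀ hσ => by
      refine notMem_medialAxis_of_dist_lt (p := p) ?_
      have hσpos : 0 < σ := ht₀.trans_le hσ₀
      refine lt_of_pow_lt_pow_left₀ 2 ((norm_nonneg _).trans hqp.le) ?_
      rw [dist_comm, dist_eq_norm, show q + σ • n - p = (q - p) + σ • n by abel, norm_add_sq_real,
        inner_smul_right, norm_smul, hn1, Real.norm_eq_abs, mul_one, sq_abs]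
      have h1 : 0 < t + 2 * a := pos_of_mul_pos_right (by linarith) ht.le
      have h2 : σ * (σ + 2 * a) < t * (t + 2 * a) := by
        -- The squared distance from `p` of a center at height `σ` is `s² + σ(σ + 2a)`, with value
        -- `ℓ²` at the exit height `t`.
        rcases le_or_gt (σ + 2 * a) 0 with h3 | h3
        · nlinarith [mul_nonneg hσpos.le (neg_nonneg.2 h3), mul_pos ht h1]
        · exact mul_lt_mul'' hσ (by linarith) hσpos.le h3.le
      change ‖q - p‖ ^ 2 + 2 * (σ * a) + σ ^ 2 < ℓ ^ 2
      linarith)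
  have h := disjoint_ball_iff_forall_le.1 hball z hz
  have h' := pow_le_pow_left₀ ht.le h 2
  rw [dist_eq_norm, ← sub_sub, norm_sub_sq_real, inner_smul_right, norm_smul, hn1,
    Real.norm_eq_abs, mul_one, sq_abs] at h'
  linarith

/-- The point `p` itself lies outside the balls touching at `q` with normals `±n`. Their exit length
involves the inner product to be bounded; eliminating it gives the same bound as a ball of radius
`lfs S p`. -/
theorem IsSubmanifold.abs_inner_le (hS : IsSubmanifold k S) (hSc : IsCompact S) (hp : p ∈ S)
    (hq : q ∈ S) (hqp : ‖q - p‖ < lfs S p) (hn : n ∈ (tangentDirection S q)ᗮ) (hn1 : ‖n‖ = 1) :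
    2 * lfs S p * |inner ℝ (q - p) n| ≤ ‖q - p‖ ^ 2 := by
  have hs : ‖q - p‖ ^ 2 < lfs S p ^ 2 := pow_lt_pow_left₀ hqp (norm_nonneg _) two_ne_zero
  have hℓ : 0 < lfs S p := (norm_nonneg _).trans_lt hqp
  have key : ∀ m ∈ (tangentDirection S q)ᗮ, ‖m‖ = 1 →
      -(2 * lfs S p * inner ℝ (q - p) m) ≤ ‖q - p‖ ^ 2 := by
    intro m hm hm1
    have h1 := hS.exitLength_mul_inner_le hSc hq hqp hm hm1 hp
    rw [← neg_sub q p, inner_neg_left, norm_neg] at h1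
    have h2 := exitLength_mul_add (a := inner ℝ (q - p) m) hs
    have h3 := exitLength_pos (a := inner ℝ (q - p) m) hs
    set t := exitLength (lfs S p) ‖q - p‖ (inner ℝ (q - p) m)
    set a := inner ℝ (q - p) m
    set ℓ := lfs S p
    have h4 : t ≤ ℓ := abs_le_of_sq_le_sq' (by nlinarith) hℓ.le |>.2
    have h5 : 0 ≤ (ℓ - t) * (ℓ * t + (ℓ ^ 2 - ‖q - p‖ ^ 2)) :=
      mul_nonneg (by linarith) (by nlinarith [mul_pos hℓ h3])
    refine le_of_mul_le_mul_right ?_ h3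
    linear_combination h5 - ℓ * h2
  rcases abs_cases (inner ℝ (q - p) n) with ⟨h, -⟩ | ⟨h, -⟩
  · have := key (-n) (Submodule.neg_mem _ hn) (by rwa [norm_neg])
    rw [inner_neg_right] at this
    rw [h]; linarith
  · have := key n hn hn1
    rw [h]; linarith

/-- The tangential component of `q - p` is almost all of it. -/
theorem IsSubmanifold.le_norm_sq_starProjection (hS : IsSubmanifold k S) (hSc : IsCompact S)
    (hp : p ∈ S) (hq : q ∈ S) (hqp : ‖q - p‖ < lfs S p) :
    4 * lfs S p ^ 2 * ‖q - p‖ ^ 2 - ‖q - p‖ ^ 4 ≤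
      4 * lfs S p ^ 2 * ‖(tangentDirection S q).starProjection (q - p)‖ ^ 2 := by
  set T := tangentDirection S q with hT
  set g := q - p with hg
  set m := Tᗮ.starProjection g with hm
  have hℓ : 0 < lfs S p := (norm_nonneg _).trans_lt hqp
  have hmT : m ∈ Tᗮ := Submodule.starProjection_apply_mem _ _
  have hpyth : ‖g‖ ^ 2 = ‖T.starProjection g‖ ^ 2 + ‖m‖ ^ 2 :=
    Submodule.norm_sq_eq_add_norm_sq_starProjection g T
  have hm2 : 2 * lfs S p * ‖m‖ ≤ ‖g‖ ^ 2 := by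
    rcases eq_or_ne m 0 with h0 | h0
    · rw [h0, norm_zero, mul_zero]; positivity
    · have hmpos : 0 < ‖m‖ := norm_pos_iff.2 h0
      have h1 := hS.abs_inner_le hSc hp hq hqp (n := ‖m‖⁻¹ • m) (Submodule.smul_mem _ _ hmT)
        (by rw [norm_smul, norm_inv, norm_norm, inv_mul_cancel₀ hmpos.ne'])
      have h2 : inner ℝ g m = ‖m‖ ^ 2 := by
        have h3 : inner ℝ (g - m) m = 0 := Submodule.starProjection_inner_eq_zero g m hmT
        rw [inner_sub_left, real_inner_self_eq_norm_sq] at h3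
        linarith
      rw [inner_smul_right, h2, sq, ← mul_assoc, inv_mul_cancel₀ hmpos.ne', one_mul, abs_norm] at h1
      exact h1
  have h3 : (2 * lfs S p * ‖m‖) ^ 2 ≤ (‖g‖ ^ 2) ^ 2 :=
    pow_le_pow_left₀ (by positivity) hm2 2
  nlinarith

/-- If a curve has velocity `v` and its unit normal field has derivative `-τ`, then second-order
contact of the curve with its tangent space is governed by `⟪v, τ⟫`. -/
theorem tendsto_inner_div_sq {c c' ν : ℝ → EuclideanSpace ℝ (Fin d)}
    (hν : HasDerivAt ν (-τ) 0) (hc' : ContinuousAt c' 0)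
    (hc : ∀ᶠ t in 𝓝 0, HasDerivAt c (c' t) t ∧ inner ℝ (c' t) (ν t) = 0) :
    Tendsto (fun t => inner ℝ (c t - c 0) (ν 0) / t ^ 2) (𝓝[>] 0)
      (𝓝 (inner ℝ (c' 0) τ / 2)) := by
  have hgt : ∀ {P : ℝ → Prop}, (∀ᶠ t in 𝓝 0, P t) → ∀ᶠ t in 𝓝[>] 0, P t :=
    fun h => nhdsWithin_le_nhds h
  -- L'Hôpital avoids a second derivative of `c`: since `c'` is orthogonal to `ν`, the quotient `⟪c'
  -- t, ν 0⟫ / (2t)` is a difference quotient of `ν`.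
  refine HasDerivAt.lhopital_zero_nhdsGT (f' := fun t => inner ℝ (c' t) (ν 0))
    (g' := fun t => 2 * t) ?_ ?_ ?_ ?_ ?_ ?_
  · filter_upwards [hgt hc] with t ht
    simpa using (ht.1.sub_const (c 0)).inner ℝ (hasDerivAt_const t (ν 0))
  · exact Eventually.of_forall fun t => by simpa using hasDerivAt_pow 2 t
  · filter_upwards [self_mem_nhdsWithin] with t ht
    have : (0 : ℝ) < t := ht
    positivity
  · have h1 : ContinuousAt (fun t => inner ℝ (c t - c 0) (ν 0)) 0 :=
      (hc.self_of_nhds.1.continuousAt.sub continuousAt_const).inner (𝕜 := ℝ) continuousAt_const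
    have := h1.tendsto.mono_left (nhdsWithin_le_nhds (s := Set.Ioi 0))
    simpa using this
  · have := ((continuous_pow 2 : Continuous fun t : ℝ => t ^ 2).tendsto 0).mono_left
      (nhdsWithin_le_nhds (s := Set.Ioi 0))
    simpa using this
  · have h1 := hν.tendsto_slope_zero_right
    have h2 := (hc'.tendsto.mono_left (nhdsWithin_le_nhds (s := Set.Ioi 0))).inner (𝕜 := ℝ) h1
    rw [inner_neg_right] at h2
    have h3 := h2.neg.div_const 2
    rw [neg_neg] at h3
    refine h3.congr' ?_
    filter_upwards [hgt hc, self_mem_nhdsWithin] with t ht htpos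
    have htpos : (0 : ℝ) < t := htpos
    rw [zero_add, inner_smul_right, inner_sub_right, ht.2]
    field_simp
    ring

/-- The basic second-order inequality between two tangent balls. -/
theorem IsSubmanifold.second_order_inequality (hS : IsSubmanifold k S) (hSc : IsCompact S)
    (hqp : ‖q - p‖ < lfs S p) {c c' ν : ℝ → EuclideanSpace ℝ (Fin d)}
    (hc0 : c 0 = q) (hc'0 : c' 0 = v) (hν0 : ν 0 = n) (hc'c : ContinuousAt c' 0)
    (hν : HasDerivAt ν (-τ) 0)
    (hc : ∀ᶠ t in 𝓝 0, c t ∈ S ∧ ν t ∈ (tangentDirection S (c t))ᗮ ∧ ‖ν t‖ = 1 ∧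
        HasDerivAt c (c' t) t ∧ c' t ∈ tangentDirection S (c t))
    {x : EuclideanSpace ℝ (Fin d)} (hx : x ∈ tangentDirection S q) :
    0 ≤ inner ℝ (x - v) τ + inner ℝ v τ / 2 +
      ‖x‖ ^ 2 / (2 * exitLength (lfs S p) ‖q - p‖ (inner ℝ (q - p) (-n))) +
      ‖x - v‖ ^ 2 / (2 * exitLength (lfs S p) ‖q - p‖ (inner ℝ (q - p) n)) := by
  have hgt : ∀ {P : ℝ → Prop}, (∀ᶠ t in 𝓝 0, P t) → ∀ᶠ t in 𝓝[>] 0, P t :=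
    fun h => nhdsWithin_le_nhds h
  have hs : ‖q - p‖ ^ 2 < lfs S p ^ 2 := pow_lt_pow_left₀ hqp (norm_nonneg _) two_ne_zero
  obtain ⟨hqS, hnT, hn1, hcd, -⟩ := hc.self_of_nhds
  rw [hc0] at hqS hnT
  rw [hν0] at hnT hn1
  rw [hc'0] at hcd
  obtain ⟨_, -, z, z', _, hz0, hz'0, -, -, -, hz⟩ := hS.exists_curve hqS hnT hn1 hx
  have hzd : HasDerivAt z x 0 := hz'0 ▸ hz.self_of_nhds.2.2.2.1
  set e : ℝ → ℝ := fun t => exitLength (lfs S p) ‖c t - p‖ (inner ℝ (c t - p) (ν t)) with he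
  set e' := exitLength (lfs S p) ‖q - p‖ (inner ℝ (q - p) (-n)) with he'
  have hec : ContinuousAt e 0 := by
    have h1 := hcd.continuousAt
    have h2 := hν.continuousAt
    have h3 : ContinuousAt (fun t => inner ℝ (c t - p) (ν t)) 0 :=
      (h1.sub continuousAt_const).inner (𝕜 := ℝ) h2
    simp only [he, exitLength]
    exact h3.neg.add (((h3.pow 2).add (continuousAt_const.sub
      ((h1.sub continuousAt_const).norm.pow 2))).sqrt)
  have he0 : e 0 = exitLength (lfs S p) ‖q - p‖ (inner ℝ (q - p) n) := by simp [he, hc0, hν0]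
  have he0pos : 0 < e 0 := he0 ▸ exitLength_pos hs
  have he'pos : 0 < e' := exitLength_pos hs
  have hzs := hzd.tendsto_slope_zero_right
  have hcs := hcd.tendsto_slope_zero_right
  have hνs := hν.tendsto_slope_zero_right
  have hquad := tendsto_inner_div_sq hν hc'c (hc.mono fun t ht =>
    ⟨ht.2.2.2.1, Submodule.inner_right_of_mem_orthogonal ht.2.2.2.2 ht.2.1⟩)
  have helim : Tendsto e (𝓝[>] 0) (𝓝 (e 0)) := hec.tendsto.mono_left nhdsWithin_le_nhds
  have hlim := ((((hzs.sub hcs).inner (𝕜 := ℝ) hνs.neg).add hquad).add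
    ((hzs.norm.pow 2).div_const (2 * e'))).add
    (((hzs.sub hcs).norm.pow 2).div (helim.const_mul 2) (by positivity))
  rw [neg_neg, hc'0, he0] at hlim
  refine ge_of_tendsto hlim ?_
  have hnear : ∀ᶠ t in 𝓝 0, ‖c t - p‖ < lfs S p := by
    have : ContinuousAt (fun t => ‖c t - p‖) 0 := (hcd.continuousAt.sub continuousAt_const).norm
    exact this.eventually_lt_const (by simpa [hc0] using hqp)
  filter_upwards [hgt hc, hgt hz, hgt hnear, self_mem_nhdsWithin] with t hct hzt hnt ht
  have ht : (0 : ℝ) < t := ht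
  have hstt : ‖c t - p‖ ^ 2 < lfs S p ^ 2 := pow_lt_pow_left₀ hnt (norm_nonneg _) two_ne_zero
  have het : 0 < e t := exitLength_pos hstt
  -- The same point `z t` is kept out of the ball below `q` and the ball above `c t`. Adding the two
  -- conditions cancels the first-order terms; division by `t ^ 2` leaves the claim in the limit.
  have h1 : 2 * e' * inner ℝ (z t - q) (-n) ≤ ‖z t - q‖ ^ 2 :=
    hS.exitLength_mul_inner_le hSc hqS hqp (Submodule.neg_mem _ hnT) (by rwa [norm_neg]) hzt.1
  have h2 : 2 * e t * inner ℝ (z t - c t) (ν t) ≤ ‖z t - c t‖ ^ 2 :=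
    hS.exitLength_mul_inner_le hSc hct.1 hnt hct.2.1 hct.2.2.1 hzt.1
  have h1' : -inner ℝ (z t - q) n ≤ ‖z t - q‖ ^ 2 / (2 * e') := by
    rw [le_div_iff₀ (by positivity)]
    rw [inner_neg_right] at h1
    linarith
  have h2' : inner ℝ (z t - c t) (ν t) ≤ ‖z t - c t‖ ^ 2 / (2 * e t) := by
    rw [le_div_iff₀ (by positivity)]
    linarith
  have h3 : inner ℝ (z t - c t) (n - ν t) + inner ℝ (c t - q) n =
      inner ℝ (z t - q) n - inner ℝ (z t - c t) (ν t) := by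
    rw [inner_sub_right, show z t - q = (z t - c t) + (c t - q) by abel, inner_add_left]
    ring
  have h4 : 0 ≤ (inner ℝ (z t - c t) (n - ν t) + inner ℝ (c t - q) n +
      ‖z t - q‖ ^ 2 / (2 * e') + ‖z t - c t‖ ^ 2 / (2 * e t)) / t ^ 2 := by
    refine div_nonneg ?_ (by positivity)
    rw [h3]; linarith
  refine h4.trans_eq ?_
  simp only [Pi.div_apply, zero_add, hz0, hc0, hν0]
  rw [← smul_sub, show z t - q - (c t - q) = z t - c t by abel, ← smul_neg, neg_sub,
    inner_smul_left, inner_smul_right, norm_smul, norm_smul, mul_pow, mul_pow, norm_inv,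
    Real.norm_eq_abs, abs_of_pos ht]
  simp only [conj_trivial]
  field_simp

/-- The derivative of a unit normal field with tangential derivative, controlled by tangent balls. -/
theorem IsSubmanifold.norm_sq_derivative_le (hS : IsSubmanifold k S) (hSc : IsCompact S)
    (hqp : ‖q - p‖ < lfs S p) (hv : v ∈ tangentDirection S q) (hτ : τ ∈ tangentDirection S q)
    {c c' ν : ℝ → EuclideanSpace ℝ (Fin d)}
    (hc0 : c 0 = q) (hc'0 : c' 0 = v) (hν0 : ν 0 = n) (hc'c : ContinuousAt c' 0)
    (hν : HasDerivAt ν (-τ) 0)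
    (hc : ∀ᶠ t in 𝓝 0, c t ∈ S ∧ ν t ∈ (tangentDirection S (c t))ᗮ ∧ ‖ν t‖ = 1 ∧
        HasDerivAt c (c' t) t ∧ c' t ∈ tangentDirection S (c t)) :
    (lfs S p ^ 2 - ‖q - p‖ ^ 2) * ‖τ‖ ^ 2 ≤
      2 * inner ℝ (q - p) n * inner ℝ v τ + ‖v‖ ^ 2 := by
  have hs : ‖q - p‖ ^ 2 < lfs S p ^ 2 := pow_lt_pow_left₀ hqp (norm_nonneg _) two_ne_zero
  set a := inner ℝ (q - p) n with ha
  set t := exitLength (lfs S p) ‖q - p‖ a with ht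
  have htpos : 0 < t := exitLength_pos hs
  have hta : t * (t + 2 * a) = lfs S p ^ 2 - ‖q - p‖ ^ 2 := exitLength_mul_add hs
  have ht' : 0 < t + 2 * a := pos_of_mul_pos_right (by linarith) htpos.le
  -- the minimizer of the quadratic function of `second_order_inequality`
  set x := ((t + 2 * a) / (2 * (t + a))) • v - (t * (t + 2 * a) / (2 * (t + a))) • τ with hx
  have hxT : x ∈ tangentDirection S q :=
    Submodule.sub_mem _ (Submodule.smul_mem _ _ hv) (Submodule.smul_mem _ _ hτ)
  have key := hS.second_order_inequality hSc hqp hc0 hc'0 hν0 hc'c hν hc hxT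
  rw [inner_neg_right, exitLength_neg, ← ha, ← ht] at key
  rw [← hta]
  have hsum : 0 < t + a := by linarith
  have e1 : inner ℝ (x - v) τ = (t + 2 * a) / (2 * (t + a)) * inner ℝ v τ -
      t * (t + 2 * a) / (2 * (t + a)) * ‖τ‖ ^ 2 - inner ℝ v τ := by
    rw [hx, inner_sub_left, inner_sub_left, real_inner_smul_left, real_inner_smul_left,
      real_inner_self_eq_norm_sq]
  have e2 : ‖x‖ ^ 2 = ((t + 2 * a) / (2 * (t + a))) ^ 2 * ‖v‖ ^ 2 -
      2 * ((t + 2 * a) / (2 * (t + a))) * (t * (t + 2 * a) / (2 * (t + a))) * inner ℝ v τ +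
      (t * (t + 2 * a) / (2 * (t + a))) ^ 2 * ‖τ‖ ^ 2 := by
    rw [hx, norm_sub_sq_real, norm_smul, norm_smul, mul_pow, mul_pow, Real.norm_eq_abs,
      Real.norm_eq_abs, sq_abs, sq_abs, real_inner_smul_left, real_inner_smul_right]
    ring
  have e3 : inner ℝ x v = (t + 2 * a) / (2 * (t + a)) * ‖v‖ ^ 2 -
      t * (t + 2 * a) / (2 * (t + a)) * inner ℝ v τ := by
    rw [hx, inner_sub_left, real_inner_smul_left, real_inner_smul_left,
      real_inner_self_eq_norm_sq, real_inner_comm τ v]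
  rw [norm_sub_sq_real x v, e1, e2, e3] at key
  have key2 := mul_nonneg (show 0 ≤ 4 * (t + a) by linarith) key
  have : 4 * (t + a) * ((t + 2 * a) / (2 * (t + a)) * inner ℝ v τ -
      t * (t + 2 * a) / (2 * (t + a)) * ‖τ‖ ^ 2 - inner ℝ v τ + inner ℝ v τ / 2 +
      (((t + 2 * a) / (2 * (t + a))) ^ 2 * ‖v‖ ^ 2 -
      2 * ((t + 2 * a) / (2 * (t + a))) * (t * (t + 2 * a) / (2 * (t + a))) * inner ℝ v τ +
      (t * (t + 2 * a) / (2 * (t + a))) ^ 2 * ‖τ‖ ^ 2) / (2 * (t + 2 * a)) +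
      ((((t + 2 * a) / (2 * (t + a))) ^ 2 * ‖v‖ ^ 2 -
      2 * ((t + 2 * a) / (2 * (t + a))) * (t * (t + 2 * a) / (2 * (t + a))) * inner ℝ v τ +
      (t * (t + 2 * a) / (2 * (t + a))) ^ 2 * ‖τ‖ ^ 2) -
      2 * ((t + 2 * a) / (2 * (t + a)) * ‖v‖ ^ 2 -
      t * (t + 2 * a) / (2 * (t + a)) * inner ℝ v τ) + ‖v‖ ^ 2) / (2 * t)) =
      2 * a * inner ℝ v τ + ‖v‖ ^ 2 - t * (t + 2 * a) * ‖τ‖ ^ 2 := by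
    field_simp
    ring
  linarith

end LocalEstimate

/-! ### Monotonicity and growth of the variation bounds -/

section Eta

theorem one_sub_sq_pos {σ : ℝ} (h₀ : 0 ≤ σ) (h₁ : σ < 1) : 0 < 1 - σ ^ 2 := by nlinarith

theorem eta₁_zero : eta₁ 0 = 0 := by simp [eta₁]

theorem eta₁_eventuallyEq {σ : ℝ} (h₁ : σ < 1) :
    eta₁ =ᶠ[𝓝 σ] fun δ => Real.arccos (1 - δ ^ 2 / (2 * √(1 - δ ^ 2))) := by
  filter_upwards [Iio_mem_nhds h₁] with δ hδ
  rw [eta₁, if_pos (show δ < 1 from hδ)]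

theorem continuousAt_eta₁ {σ : ℝ} (h₀ : 0 ≤ σ) (h₁ : σ < 1) : ContinuousAt eta₁ σ := by
  refine ContinuousAt.congr ?_ (eta₁_eventuallyEq h₁).symm
  have h : 2 * √(1 - σ ^ 2) ≠ 0 := by
    have := Real.sqrt_pos.2 (one_sub_sq_pos h₀ h₁)
    positivity
  refine Real.continuous_arccos.continuousAt.comp ?_
  refine continuousAt_const.sub (ContinuousAt.div (by fun_prop) (by fun_prop) h)

theorem div_sqrt_le_div_sqrt {σ δ : ℝ} (h₀ : 0 ≤ σ) (h : σ ≤ δ) (h₁ : δ < 1) :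
    σ ^ 2 / √(1 - σ ^ 2) ≤ δ ^ 2 / √(1 - δ ^ 2) := by
  have hδ := Real.sqrt_pos.2 (one_sub_sq_pos (h₀.trans h) h₁)
  have hsq : σ ^ 2 ≤ δ ^ 2 := pow_le_pow_left₀ h₀ h 2
  exact div_le_div₀ (sq_nonneg _) hsq hδ (Real.sqrt_le_sqrt (by linarith))

theorem eta₁_le_eta₁ {σ δ : ℝ} (h₀ : 0 ≤ σ) (h : σ ≤ δ) (h₁ : δ < 1) : eta₁ σ ≤ eta₁ δ := by
  rw [eta₁, eta₁, if_pos h₁, if_pos (h.trans_lt h₁)]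
  refine Real.arccos_le_arccos ?_
  have := div_sqrt_le_div_sqrt h₀ h h₁
  rw [mul_comm 2, mul_comm 2, ← div_div, ← div_div]
  linarith

/-- With `X = δ² / √(1 - δ²)` this is `√(1 - X) ≤ 1 - X / 2`. It lets the codimension-one bound
serve in every codimension. -/
theorem eta₁_le_eta₂ {δ : ℝ} (h₁ : δ < 1) (h : eta₂ δ < π / 2) : eta₁ δ ≤ eta₂ δ := by
  rw [eta₂, if_pos h₁] at h ⊢
  rw [eta₁, if_pos h₁]
  refine Real.arccos_le_arccos ?_
  set X := δ ^ 2 / √(1 - δ ^ 2) with hX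
  have hpos : 0 < √(1 - X) := by
    by_contra hcon
    have : √(1 - X) = 0 := le_antisymm (not_lt.1 hcon) (Real.sqrt_nonneg _)
    rw [this, Real.arccos_zero] at h
    exact lt_irrefl _ h
  have hX1 : 0 < 1 - X := Real.sqrt_pos.1 hpos
  have hX0 : 0 ≤ X := by positivity
  rw [mul_comm 2, ← div_div, ← hX]
  refine (Real.sqrt_le_left (by linarith)).2 ?_
  nlinarith

/-- The bound `eta₁` grows at least as fast as required by the tangent ball estimates. -/
theorem exists_hasDerivAt_eta₁ {σ : ℝ} (h₀ : 0 < σ) (h₁ : σ < 1) (hlt : eta₁ σ < π) :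
    ∃ e, HasDerivAt eta₁ e σ ∧ 1 / 2 + 1 / (2 * ((1 - σ ^ 2) * (1 - σ ^ 2 / 4))) ≤ e := by
  have hC : 0 < 1 - σ ^ 2 := one_sub_sq_pos h₀.le h₁
  set c := √(1 - σ ^ 2) with hc
  have hcpos : 0 < c := Real.sqrt_pos.2 hC
  have hc2 : c ^ 2 = 1 - σ ^ 2 := Real.sq_sqrt hC.le
  have hD : 0 < 1 - σ ^ 2 / 4 := by nlinarith
  set X := σ ^ 2 / (2 * c) with hX
  have hXpos : 0 < X := by positivity
  have hX2 : X < 2 := by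
    by_contra hcon
    rw [eta₁, if_pos h₁, Real.arccos_of_le_neg_one (by linarith)] at hlt
    exact lt_irrefl _ hlt
  have hcd : HasDerivAt (fun δ : ℝ => √(1 - δ ^ 2)) (-σ / c) σ := by
    have := ((hasDerivAt_pow 2 σ).const_sub 1).sqrt hC.ne'
    convert this using 1
    rw [← hc]
    field_simp
    ring
  have hXd : HasDerivAt (fun δ : ℝ => 1 - δ ^ 2 / (2 * √(1 - δ ^ 2)))
      (-(σ * (1 + c ^ 2) / (2 * c ^ 3))) σ := by
    have := ((hasDerivAt_pow 2 σ).div (hcd.const_mul 2) (by positivity)).const_sub 1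
    refine this.congr_deriv ?_
    rw [← hc]
    have hσ : σ ^ 2 = 1 - c ^ 2 := by linarith
    field_simp
    simp only [Nat.cast_ofNat]
    linear_combination -σ * hσ
  have hd := (Real.hasDerivAt_arccos (x := 1 - X) (by linarith) (by linarith)).comp σ hXd
  refine ⟨_, hd.congr_of_eventuallyEq (eta₁_eventuallyEq h₁), ?_⟩
  have hrad : 1 - (1 - X) ^ 2 = X * (2 - X) := by ring
  have hradpos : 0 < √(1 - (1 - X) ^ 2) := Real.sqrt_pos.2 (by rw [hrad]; exact mul_pos hXpos (by linarith))
  rw [show -(1 / √(1 - (1 - X) ^ 2)) * -(σ * (1 + c ^ 2) / (2 * c ^ 3)) =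
    (σ * (1 + c ^ 2) / (2 * c ^ 3)) / √(1 - (1 - X) ^ 2) by ring, le_div_iff₀ hradpos]
  refine abs_le_of_sq_le_sq' ?_ (by positivity) |>.2
  rw [mul_pow, Real.sq_sqrt (by rw [hrad]; nlinarith), hrad, ← hc2]
  set D := 1 - σ ^ 2 / 4 with hDdef
  have hσ : σ ^ 2 = 1 - c ^ 2 := by linarith
  have hc1 : c < 1 := by nlinarith
  -- After squaring and clearing denominators this is all that remains. It splits into `c - σ²/4 ≤
  -- D²`, a consequence of `c ≤ (1 + c²)/2`, and `D ≤ 1`.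
  have key : (c ^ 2 * D + 1) ^ 2 * (c - σ ^ 2 / 4) ≤ (1 + c ^ 2) ^ 2 * D ^ 2 := by
    have hD1 : D ≤ 1 := by rw [hDdef]; nlinarith
    have h1 : c - σ ^ 2 / 4 ≤ D ^ 2 := by
      rw [hDdef]; nlinarith [sq_nonneg (c - 1), sq_nonneg (σ ^ 2)]
    have h2 : (c ^ 2 * D + 1) ^ 2 ≤ (1 + c ^ 2) ^ 2 := by
      refine pow_le_pow_left₀ (by positivity) ?_ 2
      nlinarith [sq_nonneg c]
    exact (mul_le_mul_of_nonneg_left h1 (sq_nonneg _)).trans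
      (mul_le_mul_of_nonneg_right h2 (sq_nonneg _))
  have e1 : (1 / 2 + 1 / (2 * (c ^ 2 * D))) ^ 2 * (X * (2 - X)) =
      σ ^ 2 / (4 * c ^ 6 * D ^ 2) * ((c ^ 2 * D + 1) ^ 2 * (c - σ ^ 2 / 4)) := by
    rw [hX]; field_simp; ring
  have e2 : (σ * (1 + c ^ 2) / (2 * c ^ 3)) ^ 2 =
      σ ^ 2 / (4 * c ^ 6 * D ^ 2) * ((1 + c ^ 2) ^ 2 * D ^ 2) := by
    field_simp; ring
  rw [e1, e2]
  exact mul_le_mul_of_nonneg_left key (by positivity)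

end Eta

/-! ### Turning speed of unit vectors -/

section NormalVariation

variable {E : Type*} [NormedAddCommGroup E] [InnerProductSpace ℝ E]

/-- The sine of the angle is at most the chord. The sharper half-angle formula is not needed, as
only the slope of `arcsin` at `0` matters. -/
theorem angle_le_arcsin_norm_sub {x y : E} (hx : ‖x‖ = 1) (hy : ‖y‖ = 1) (h : 0 ≤ inner ℝ x y) :
    angle x y ≤ Real.arcsin ‖y - x‖ := by
  have hle : angle x y ≤ π / 2 := by
    rw [angle, hx, hy, mul_one, div_one]
    exact Real.arccos_le_pi_div_two.2 h
  have hcos : Real.cos (angle x y) = inner ℝ x y := by rw [cos_angle, hx, hy]; simp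
  have hsin : 0 ≤ Real.sin (angle x y) := sin_angle_nonneg x y
  rw [← Real.arcsin_sin (by linarith [angle_nonneg x y, Real.pi_pos]) hle]
  refine Real.monotone_arcsin (abs_le_of_sq_le_sq' ?_ (norm_nonneg _) |>.2)
  rw [norm_sub_sq_real, hx, hy, Real.sin_sq, hcos, real_inner_comm]
  nlinarith [sq_nonneg (inner ℝ y x - 1)]

/-- A differentiable family of unit vectors turns with the speed of its derivative. -/
theorem eventually_angle_le {ν : ℝ → E} {τ : E} (hν : HasDerivAt ν (-τ) 0)
    (hν1 : ∀ᶠ t in 𝓝 0, ‖ν t‖ = 1) {η : ℝ} (hη : 0 < η) :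
    ∀ᶠ t in 𝓝[>] (0 : ℝ), angle (ν 0) (ν t) ≤ t * (‖τ‖ + η) := by
  have h01 : ‖ν 0‖ = 1 := hν1.self_of_nhds
  have hpos : ∀ᶠ t in 𝓝 (0 : ℝ), 0 < inner ℝ (ν 0) (ν t) := by
    have : ContinuousAt (fun t => inner ℝ (ν 0) (ν t)) 0 :=
      continuousAt_const.inner (𝕜 := ℝ) hν.continuousAt
    exact this.eventually_const_lt (by
      change 0 < inner ℝ (ν 0) (ν 0)
      rw [real_inner_self_eq_norm_sq, h01]; norm_num)
  have harc : HasDerivAt Real.arcsin 1 0 := by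
    have := Real.hasDerivAt_arcsin (x := 0) (by norm_num) (by norm_num)
    simpa using this
  -- The identity `arcsin r = r * dslope arcsin 0 r` also covers `r = 0`, where `ν` may not move at
  -- all.
  have hds : ContinuousAt (dslope Real.arcsin 0) 0 := continuousAt_dslope_same.2 harc.differentiableAt
  have hds0 : dslope Real.arcsin 0 0 = 1 := by rw [dslope_same, harc.deriv]
  have hg : ContinuousAt (fun t => ‖ν t - ν 0‖) 0 := (hν.continuousAt.sub continuousAt_const).norm
  have hcomp : Tendsto (fun t => dslope Real.arcsin 0 ‖ν t - ν 0‖) (𝓝[>] 0) (𝓝 1) := by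
    have h1 : ContinuousAt (fun t => dslope Real.arcsin 0 ‖ν t - ν 0‖) 0 :=
      ContinuousAt.comp (f := fun t => ‖ν t - ν 0‖) (by
        change ContinuousAt (dslope Real.arcsin 0) ‖ν 0 - ν 0‖
        rwa [sub_self, norm_zero]) hg
    have := h1.tendsto.mono_left (nhdsWithin_le_nhds (s := Set.Ioi 0))
    simpa [hds0] using this
  have hlim := hcomp.mul hν.tendsto_slope_zero_right.norm
  rw [one_mul, norm_neg] at hlim
  have hev := hlim.eventually_lt_const (u := ‖τ‖ + η) (by linarith)
  filter_upwards [hev, nhdsWithin_le_nhds hν1, nhdsWithin_le_nhds hpos, self_mem_nhdsWithin]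
    with t ht ht1 htpos ht0
  have ht0 : 0 < t := ht0
  refine (angle_le_arcsin_norm_sub h01 ht1 htpos.le).trans ?_
  have h2 : Real.arcsin ‖ν t - ν 0‖ = ‖ν t - ν 0‖ * dslope Real.arcsin 0 ‖ν t - ν 0‖ := by
    have := sub_smul_dslope Real.arcsin 0 ‖ν t - ν 0‖
    simpa using this.symm
  rw [zero_add, norm_smul, norm_inv, Real.norm_eq_abs, abs_of_pos ht0] at ht
  have h3 := mul_le_mul_of_nonneg_left ht.le ht0.le
  refine le_trans (le_of_eq ?_) h3
  rw [h2]
  field_simp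

/-- By Cauchy–Schwarz the quotient is at most `‖f‖ ‖g‖² / (2|ℓ|)` in absolute value, so the value
`0` given by division by zero is the correct limit where `f` vanishes. This makes `normalPotential`
continuous up to `p`. -/
theorem continuousAt_inner_sq_div_norm {X : Type*} [TopologicalSpace X] {f g : X → E} {x : X}
    (hf : ContinuousAt f x) (hg : ContinuousAt g x) (ℓ : ℝ) :
    ContinuousAt (fun y => inner ℝ (f y) (g y) ^ 2 / (2 * ‖f y‖ * ℓ)) x := by
  have hi : ContinuousAt (fun y => inner ℝ (f y) (g y)) x := hf.inner (𝕜 := ℝ) hg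
  rcases eq_or_ne ℓ 0 with rfl | hℓ
  · simpa using continuousAt_const
  rcases eq_or_ne (f x) 0 with h0 | h0
  · have hb : ∀ y, ‖inner ℝ (f y) (g y) ^ 2 / (2 * ‖f y‖ * ℓ)‖ ≤ ‖f y‖ * ‖g y‖ ^ 2 / (2 * |ℓ|) := by
      intro y
      rw [norm_div, norm_pow, norm_mul, norm_mul, norm_norm, Real.norm_eq_abs, Real.norm_eq_abs,
        Real.norm_eq_abs, abs_two]
      rcases eq_or_ne (f y) 0 with hy | hy
      · simp [hy]
      have hy' : 0 < ‖f y‖ := norm_pos_iff.2 hy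
      have hℓ' : 0 < |ℓ| := abs_pos.2 hℓ
      rw [div_le_div_iff₀ (by positivity) (by positivity)]
      have h1 := pow_le_pow_left₀ (abs_nonneg _) (abs_real_inner_le_norm (f y) (g y)) 2
      calc |inner ℝ (f y) (g y)| ^ 2 * (2 * |ℓ|) ≤ (‖f y‖ * ‖g y‖) ^ 2 * (2 * |ℓ|) :=
            mul_le_mul_of_nonneg_right h1 (by positivity)
        _ = ‖f y‖ * ‖g y‖ ^ 2 * (2 * ‖f y‖ * |ℓ|) := by ring
    have hlim : Tendsto (fun y => ‖f y‖ * ‖g y‖ ^ 2 / (2 * |ℓ|)) (𝓝 x) (𝓝 0) := by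
      have := ((hf.norm.mul (hg.norm.pow 2)).div_const (2 * |ℓ|)).tendsto
      simpa [h0] using this
    have := squeeze_zero_norm hb hlim
    simpa [ContinuousAt, h0] using this
  · have : 2 * ‖f x‖ * ℓ ≠ 0 := by
      have := norm_ne_zero_iff.2 h0
      positivity
    exact (hi.pow 2).div ((continuousAt_const.mul hf.norm).mul continuousAt_const) this

end NormalVariation

/-! ### Normal variation by descent of a potential -/

section NormalVariation

variable {d k : ℕ} {S : Set (EuclideanSpace ℝ (Fin d))} {p q n : EuclideanSpace ℝ (Fin d)}

/-- The potential whose decrease towards `p` pays for the turning of a normal vector. -/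
def normalPotential (ℓ : ℝ) (g n : EuclideanSpace ℝ (Fin d)) : ℝ :=
  eta₁ (‖g‖ / ℓ) - inner ℝ g n ^ 2 / (2 * ‖g‖ * ℓ)

/-- Here `N` is the turning speed, `a'` the derivative of `a`, and `-y / s` that of `s`. By AM-GM,
`2N ≤ (2aa' + y)/(sℓ) + sℓ/(ℓ² - s²)`. The term in `aa'` cancels against the derivative of `-a² /
(2sℓ)`, which is why the potential contains it; the growth of `eta₁` covers the rest, and `ε` makes
the inequality strict. -/
theorem speed_add_potential_derivative_neg {s ℓ a a' y N e ε : ℝ} (hs : 0 < s) (hsℓ : s < ℓ)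
    (hε : 0 < ε) (hy : 0 < y)
    (hN : (ℓ ^ 2 - s ^ 2) * N ^ 2 ≤ 2 * a * a' + y)
    (hys : 4 * ℓ ^ 2 * s ^ 2 - s ^ 4 ≤ 4 * ℓ ^ 2 * y)
    (he : 1 / 2 + 1 / (2 * ((1 - (s / ℓ) ^ 2) * (1 - (s / ℓ) ^ 2 / 4))) ≤ e) :
    N + (e * (-y / s / ℓ) - (2 * a * a' * (2 * s * ℓ) - a ^ 2 * (2 * (-y / s) * ℓ)) /
      (2 * s * ℓ) ^ 2 + ε * (-y / s)) < 0 := by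
  have hℓ : 0 < ℓ := hs.trans hsℓ
  have hc : 0 < ℓ ^ 2 - s ^ 2 := by nlinarith
  have hD : 0 < 4 * ℓ ^ 2 - s ^ 2 := by nlinarith
  have h1 : N ≤ ((2 * a * a' + y) / (s * ℓ) + s * ℓ / (ℓ ^ 2 - s ^ 2)) / 2 := by
    have h2 : (ℓ ^ 2 - s ^ 2) * N ^ 2 / (s * ℓ) ≤ (2 * a * a' + y) / (s * ℓ) :=
      div_le_div_of_nonneg_right hN (by positivity)
    have h3 : 0 ≤ ((ℓ ^ 2 - s ^ 2) * N - s * ℓ) ^ 2 / (s * ℓ * (ℓ ^ 2 - s ^ 2)) := by positivity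
    have h4 : ((ℓ ^ 2 - s ^ 2) * N - s * ℓ) ^ 2 / (s * ℓ * (ℓ ^ 2 - s ^ 2)) =
        (ℓ ^ 2 - s ^ 2) * N ^ 2 / (s * ℓ) - 2 * N + s * ℓ / (ℓ ^ 2 - s ^ 2) := by
      field_simp; ring
    linarith
  have h5 : y / (2 * (s * ℓ)) + s * ℓ / (2 * (ℓ ^ 2 - s ^ 2)) ≤ e * y / (s * ℓ) := by
    have h6 : (1 / 2 + 1 / (2 * ((1 - (s / ℓ) ^ 2) * (1 - (s / ℓ) ^ 2 / 4)))) * y / (s * ℓ) ≤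
        e * y / (s * ℓ) :=
      div_le_div_of_nonneg_right (mul_le_mul_of_nonneg_right he hy.le) (by positivity)
    refine le_trans ?_ h6
    have h7 : (1 / 2 + 1 / (2 * ((1 - (s / ℓ) ^ 2) * (1 - (s / ℓ) ^ 2 / 4)))) * y / (s * ℓ) =
        y / (2 * (s * ℓ)) +
          (4 * ℓ ^ 2 * y) * (ℓ / (2 * s * (ℓ ^ 2 - s ^ 2) * (4 * ℓ ^ 2 - s ^ 2))) := by
      have h8 : 1 - (s / ℓ) ^ 2 = (ℓ ^ 2 - s ^ 2) / ℓ ^ 2 := by field_simp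
      have h9 : 1 - (s / ℓ) ^ 2 / 4 = (4 * ℓ ^ 2 - s ^ 2) / (4 * ℓ ^ 2) := by field_simp
      rw [h8, h9]
      field_simp
    rw [h7]
    have h10 : s * ℓ / (2 * (ℓ ^ 2 - s ^ 2)) = (4 * ℓ ^ 2 * s ^ 2 - s ^ 4) *
        (ℓ / (2 * s * (ℓ ^ 2 - s ^ 2) * (4 * ℓ ^ 2 - s ^ 2))) := by
      rw [show 4 * ℓ ^ 2 * s ^ 2 - s ^ 4 = s ^ 2 * (4 * ℓ ^ 2 - s ^ 2) by ring]
      field_simp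
      rw [div_self]
      intro h0
      linarith
    rw [h10]
    gcongr
  have h11 : e * (-y / s / ℓ) - (2 * a * a' * (2 * s * ℓ) - a ^ 2 * (2 * (-y / s) * ℓ)) /
      (2 * s * ℓ) ^ 2 + ε * (-y / s) =
      -(e * y / (s * ℓ)) - a * a' / (s * ℓ) - a ^ 2 * y / (2 * s ^ 3 * ℓ) - ε * y / s := by
    field_simp
    ring
  have h12 : 0 ≤ a ^ 2 * y / (2 * s ^ 3 * ℓ) := by positivity
  have h13 : 0 < ε * y / s := by positivity
  have h14 : ((2 * a * a' + y) / (s * ℓ) + s * ℓ / (ℓ ^ 2 - s ^ 2)) / 2 =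
      a * a' / (s * ℓ) + (y / (2 * (s * ℓ)) + s * ℓ / (2 * (ℓ ^ 2 - s ^ 2))) := by
    field_simp
    ring
  rw [h11]
  linarith

/-- A unit normal at `q ≠ p` can be moved towards `p` while the potential pays for its turning. -/
theorem IsSubmanifold.exists_normal_closer (hS : IsSubmanifold k S) (hSc : IsCompact S) (hp : p ∈ S)
    (hq : q ∈ S) (hqp : ‖q - p‖ < lfs S p) (hne : q ≠ p)
    (hlt : eta₁ (‖q - p‖ / lfs S p) < π)
    (hn : n ∈ (tangentDirection S q)ᗮ) (hn1 : ‖n‖ = 1) {ε : ℝ} (hε : 0 < ε) :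
    ∃ q' ∈ S, ∃ n' ∈ (tangentDirection S q')ᗮ, ‖n'‖ = 1 ∧ ‖q' - p‖ < ‖q - p‖ ∧
      angle n n' + normalPotential (lfs S p) (q' - p) n' + ε * ‖q' - p‖ ≤
        normalPotential (lfs S p) (q - p) n + ε * ‖q - p‖ := by
  set T := tangentDirection S q with hT
  set ℓ := lfs S p with hℓdef
  set s := ‖q - p‖ with hs
  have hspos : 0 < s := norm_pos_iff.2 (sub_ne_zero.2 hne)
  have hℓ : 0 < ℓ := hspos.trans hqp
  set v := -T.starProjection (q - p) with hv
  have hvT : v ∈ T := T.neg_mem (Submodule.starProjection_apply_mem _ _)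
  have hys : 4 * ℓ ^ 2 * s ^ 2 - s ^ 4 ≤ 4 * ℓ ^ 2 * ‖v‖ ^ 2 := by
    rw [hv, norm_neg]
    exact hS.le_norm_sq_starProjection hSc hp hq hqp
  have hy : 0 < ‖v‖ ^ 2 := by
    have : 0 < 4 * ℓ ^ 2 * s ^ 2 - s ^ 4 := by
      rw [show 4 * ℓ ^ 2 * s ^ 2 - s ^ 4 = s ^ 2 * (4 * ℓ ^ 2 - s ^ 2) by ring]
      exact mul_pos (by positivity) (by nlinarith)
    by_contra hcon
    nlinarith [sq_nonneg ℓ]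
  obtain ⟨τ, hτ, c, c', ν, hc0, hc'0, hν0, hc'c, hνd, hev⟩ := hS.exists_curve hq hn hn1 hvT
  have hcd : HasDerivAt c v 0 := hc'0 ▸ hev.self_of_nhds.2.2.2.1
  have hτN := hS.norm_sq_derivative_le hSc hqp hvT hτ hc0 hc'0 hν0 hc'c hνd hev
  have hgT : ∀ w ∈ T, inner ℝ (q - p) w = -inner ℝ v w := by
    intro w hw
    have : inner ℝ (q - p - T.starProjection (q - p)) w = 0 :=
      Submodule.starProjection_inner_eq_zero _ _ hw
    rw [inner_sub_left] at this
    rw [hv, inner_neg_left]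
    linarith
  have hgd : HasDerivAt (fun t => c t - p) v 0 := hcd.sub_const p
  have hsd : HasDerivAt (fun t => ‖c t - p‖) (-‖v‖ ^ 2 / s) 0 := by
    have h1 := hgd.norm_sq
    rw [hc0, hgT v hvT, real_inner_self_eq_norm_sq] at h1
    have h2 := h1.sqrt (by simp only [hc0]; rw [← hs]; positivity)
    simp only [Real.sqrt_sq (norm_nonneg _), hc0] at h2
    refine h2.congr_deriv ?_
    rw [← hs]
    field_simp
  -- As `v` is tangential, only the rotation of `ν` changes this inner product; the choice of `v`
  -- turns `⟪q - p, -τ⟫` into `⟪v, τ⟫`.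
  have had : HasDerivAt (fun t => inner ℝ (c t - p) (ν t)) (inner ℝ v τ) 0 := by
    have h1 := hgd.inner ℝ hνd
    rw [hc0, hν0, inner_neg_right, hgT τ hτ, neg_neg,
      Submodule.inner_right_of_mem_orthogonal hvT hn, add_zero] at h1
    exact h1
  obtain ⟨e, hed, he⟩ := exists_hasDerivAt_eta₁ (σ := s / ℓ) (by positivity)
    ((div_lt_one hℓ).2 hqp) hlt
  have hFd : HasDerivAt (fun t => normalPotential ℓ (c t - p) (ν t) + ε * ‖c t - p‖)
      (e * (-‖v‖ ^ 2 / s / ℓ) - (2 * inner ℝ (q - p) n * inner ℝ v τ * (2 * s * ℓ) -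
        inner ℝ (q - p) n ^ 2 * (2 * (-‖v‖ ^ 2 / s) * ℓ)) / (2 * s * ℓ) ^ 2 +
        ε * (-‖v‖ ^ 2 / s)) 0 := by
    have h1 : HasDerivAt (fun t => eta₁ (‖c t - p‖ / ℓ)) (e * (-‖v‖ ^ 2 / s / ℓ)) 0 := by
      have hed' : HasDerivAt eta₁ e (‖c 0 - p‖ / ℓ) := by rwa [hc0]
      exact HasDerivAt.comp (h₂ := eta₁) (h := fun t => ‖c t - p‖ / ℓ) (0 : ℝ) hed'
        (hsd.div_const ℓ)
    have h2 := (had.pow 2).div ((hsd.const_mul 2).mul_const ℓ) (by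
      simp only [hc0]; rw [← hs]; positivity)
    have h3 := (h1.sub h2).add (hsd.const_mul ε)
    simp only [hc0, hν0, ← hs] at h3
    refine h3.congr_deriv ?_
    simp [hc0, hν0]
  have hneg := speed_add_potential_derivative_neg (N := ‖τ‖) hspos hqp hε hy hτN hys he
  set F' := e * (-‖v‖ ^ 2 / s / ℓ) - (2 * inner ℝ (q - p) n * inner ℝ v τ * (2 * s * ℓ) -
        inner ℝ (q - p) n ^ 2 * (2 * (-‖v‖ ^ 2 / s) * ℓ)) / (2 * s * ℓ) ^ 2 +
        ε * (-‖v‖ ^ 2 / s) with hF'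
  set η := -(‖τ‖ + F') / 2 with hη
  have hηpos : 0 < η := by linarith
  have hang := eventually_angle_le hνd (hev.mono fun t ht => ht.2.2.1) hηpos
  have hFev := (hFd.tendsto_slope_zero_right).eventually_lt_const (u := F' + η) (by linarith)
  have hsev := (hsd.tendsto_slope_zero_right).eventually_lt_const (u := 0) (by
    rw [neg_div]; exact neg_neg_of_pos (by positivity))
  obtain ⟨t, ⟨⟨⟨ht1, ht2⟩, ht3⟩, ht4⟩, ht0⟩ :=
    ((((hang.and hFev).and hsev).and (nhdsWithin_le_nhds hev)).and self_mem_nhdsWithin).exists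
  have ht0 : 0 < t := ht0
  simp only [zero_add, hc0, hν0, smul_eq_mul] at ht1 ht2 ht3
  refine ⟨c t, ht4.1, ν t, ht4.2.1, ht4.2.2.1, ?_, ?_⟩
  · rw [inv_mul_lt_iff₀ ht0, mul_zero] at ht3
    linarith
  · rw [inv_mul_lt_iff₀ ht0] at ht2
    have : t * (‖τ‖ + η) + t * (F' + η) = 0 := by rw [hη]; ring
    linarith

/-- **Normal variation**: a unit normal at `q` makes a small angle with some unit normal at `p`. -/
theorem IsSubmanifold.exists_angle_le_eta₁ (hS : IsSubmanifold k S) (hSc : IsCompact S) (hp : p ∈ S)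
    (hq : q ∈ S) (hqp : ‖q - p‖ < lfs S p) (hlt : eta₁ (‖q - p‖ / lfs S p) < π)
    (hn : n ∈ (tangentDirection S q)ᗮ) (hn1 : ‖n‖ = 1) {ε : ℝ} (hε : 0 < ε) :
    ∃ m ∈ (tangentDirection S p)ᗮ, ‖m‖ = 1 ∧ angle n m ≤ eta₁ (‖q - p‖ / lfs S p) + ε := by
  set ℓ := lfs S p with hℓdef
  have hℓ : 0 < ℓ := (norm_nonneg _).trans_lt hqp
  set δ := ε / ℓ with hδ
  have hδpos : 0 < δ := by positivity
  set B : Set (EuclideanSpace ℝ (Fin d) × EuclideanSpace ℝ (Fin d)) :=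
    ({x | x.1 ∈ S ∧ x.2 ∈ (tangentDirection S x.1)ᗮ} ∩ {x | ‖x.1 - p‖ ≤ ‖q - p‖}) ∩
      (S ×ˢ sphere 0 1) with hB
  have hBc : IsCompact B := by
    rw [hB, Set.inter_comm]
    refine (hSc.prod (isCompact_sphere 0 1)).inter_right ?_
    exact (hS.isClosed_normalBundle hSc.isClosed).inter (isClosed_le (by fun_prop) (by fun_prop))
  set f : EuclideanSpace ℝ (Fin d) × EuclideanSpace ℝ (Fin d) → ℝ := fun x =>
    Real.arccos (inner ℝ n x.2) + normalPotential ℓ (x.1 - p) x.2 + δ * ‖x.1 - p‖ with hf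
  have hfc : ContinuousOn f B := by
    intro x hx
    refine ContinuousAt.continuousWithinAt ?_
    have h1 : ContinuousAt (fun x : EuclideanSpace ℝ (Fin d) × EuclideanSpace ℝ (Fin d) =>
        x.1 - p) x := by fun_prop
    have h2 : ContinuousAt (fun x : EuclideanSpace ℝ (Fin d) × EuclideanSpace ℝ (Fin d) =>
        eta₁ (‖x.1 - p‖ / ℓ)) x := by
      refine ContinuousAt.comp (f := fun x : EuclideanSpace ℝ (Fin d) × EuclideanSpace ℝ (Fin d) =>
        ‖x.1 - p‖ / ℓ) (continuousAt_eta₁ (by positivity) ?_) (h1.norm.div_const ℓ)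
      exact (div_lt_one hℓ).2 ((show ‖x.1 - p‖ ≤ ‖q - p‖ from hx.1.2).trans_lt hqp)
    have h3 := continuousAt_inner_sq_div_norm h1 continuousAt_snd ℓ
    have h4 : ContinuousAt (fun x : EuclideanSpace ℝ (Fin d) × EuclideanSpace ℝ (Fin d) =>
        Real.arccos (inner ℝ n x.2)) x :=
      (Real.continuous_arccos.comp (by fun_prop)).continuousAt
    exact (h4.add (h2.sub h3)).add (continuousAt_const.mul h1.norm)
  -- The pairs reachable at a turning cost covered by the potential. The triangle inequality for
  -- angles keeps `exists_normal_closer` inside this set.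
  set K := B ∩ f ⁻¹' Set.Iic (f (q, n)) with hK
  have hKc : IsCompact K := hBc.of_isClosed_subset
    (hfc.preimage_isClosed_of_isClosed hBc.isClosed isClosed_Iic) Set.inter_subset_left
  have hqK : (q, n) ∈ K :=
    ⟨⟨⟨⟨hq, hn⟩, le_refl ‖q - p‖⟩, ⟨hq, by simpa using hn1⟩⟩, Set.mem_preimage.2 (Set.mem_Iic.2 le_rfl)⟩
  obtain ⟨x', hx', hmin⟩ := hKc.exists_isMinOn ⟨_, hqK⟩
    (f := fun x => ‖x.1 - p‖) (by fun_prop)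
  have hmin' : ∀ y ∈ K, ‖x'.1 - p‖ ≤ ‖y.1 - p‖ := isMinOn_iff.1 hmin
  obtain ⟨q', n'⟩ := x'
  obtain ⟨⟨⟨⟨hq', hn'⟩, hle'⟩, -, hn'1⟩, hf'⟩ := hx'
  simp only [Set.mem_ofPred_eq] at hq' hn' hle'
  have hn'1 : ‖n'‖ = 1 := by simpa using hn'1
  have hf' : f (q', n') ≤ f (q, n) := hf'
  have harc : ∀ m : EuclideanSpace ℝ (Fin d), ‖m‖ = 1 → Real.arccos (inner ℝ n m) = angle n m := by
    intro m hm
    rw [angle, hn1, hm, mul_one, div_one]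
  have hself : Real.arccos (inner ℝ n n) = 0 := by
    rw [real_inner_self_eq_norm_sq, hn1]; simp
  by_cases hqp' : q' = p
  · subst hqp'
    refine ⟨n', hn', hn'1, ?_⟩
    -- At `p` the potential vanishes, its quotient being `0 / 0 = 0`. At `q` the subtracted square
    -- is dropped, and `δ = ε / ℓ` limits the extra term to `ε`.
    simp only [hf, normalPotential, sub_self, norm_zero, zero_div, eta₁_zero, inner_zero_left,
      harc n' hn'1, hself, mul_zero, add_zero, zero_mul] at hf'
    have h1 : 0 ≤ inner ℝ (q - q') n ^ 2 / (2 * ‖q - q'‖ * ℓ) := by positivity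
    have h2 : δ * ‖q - q'‖ ≤ ε := by
      rw [hδ, div_mul_eq_mul_div, div_le_iff₀ hℓ]
      exact mul_le_mul_of_nonneg_left hqp.le hε.le
    norm_num at hf'
    linarith
  · exfalso
    have hlt' : eta₁ (‖q' - p‖ / ℓ) < π := by
      refine lt_of_le_of_lt (eta₁_le_eta₁ (by positivity) ?_ ((div_lt_one hℓ).2 hqp)) hlt
      exact div_le_div_of_nonneg_right hle' hℓ.le
    obtain ⟨q₂, hq₂, n₂, hn₂, hn₂1, hlt₂, hdec⟩ := hS.exists_normal_closer hSc hp hq'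
      (hle'.trans_lt hqp) hqp' hlt' hn' hn'1 hδpos
    have hmem : (q₂, n₂) ∈ K := by
      refine ⟨⟨⟨⟨hq₂, hn₂⟩, hlt₂.le.trans hle'⟩, hq₂, by simpa using hn₂1⟩, ?_⟩
      rw [Set.mem_preimage, Set.mem_Iic]
      refine le_trans ?_ hf'
      have htri := angle_le_angle_add_angle n n' n₂
      simp only [hf, harc n' hn'1, harc n₂ hn₂1]
      linarith
    have : ‖q' - p‖ ≤ ‖q₂ - p‖ := hmin' (q₂, n₂) hmem
    linarith

end NormalVariation

/-! ### Linear algebra of the triangle normal lemma -/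

section TriangleNormal

theorem one_le_cot_half {ψ : ℝ} (h₀ : 0 < ψ) (h₁ : ψ ≤ π / 2) : 1 ≤ Real.cot (ψ / 2) := by
  have hπ := Real.pi_pos
  have hs : 0 < Real.sin (ψ / 2) := Real.sin_pos_of_pos_of_lt_pi (by linarith) (by linarith)
  rw [Real.cot_eq_cos_div_sin, le_div_iff₀ hs, one_mul, ← Real.cos_pi_div_two_sub]
  exact Real.cos_le_cos_of_nonneg_of_le_pi (by linarith) (by linarith) (by linarith)

theorem cot_half_sq_mul {ψ : ℝ} (h₀ : 0 < ψ) (h₁ : ψ ≤ π / 2) :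
    Real.cot (ψ / 2) ^ 2 * (1 - Real.cos ψ) = 1 + Real.cos ψ := by
  have hπ := Real.pi_pos
  have hs : 0 < Real.sin (ψ / 2) := Real.sin_pos_of_pos_of_lt_pi (by linarith) (by linarith)
  have hc : Real.cos ψ = 2 * Real.cos (ψ / 2) ^ 2 - 1 := by
    rw [← Real.cos_two_mul]; congr 1; ring
  have h := Real.sin_sq_add_cos_sq (ψ / 2)
  rw [Real.cot_eq_cos_div_sin, hc, div_pow, div_mul_eq_mul_div, div_eq_iff (by positivity)]
  linear_combination (-2 * Real.cos (ψ / 2) ^ 2) * h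

variable {E : Type*} [NormedAddCommGroup E] [InnerProductSpace ℝ E]

/-- A vector in a plane which is almost orthogonal to two vectors spanning that plane is short. -/
theorem norm_le_of_abs_inner_le {a₁ a₂ g : E} {c₁ c₂ L R ψ : ℝ} (hg : g = c₁ • a₁ + c₂ • a₂)
    (hL : 0 < L) (hR : 0 < R) (h₁ : 2 * L * |inner ℝ a₁ g| ≤ ‖a₁‖ ^ 2)
    (h₂ : 2 * L * |inner ℝ a₂ g| ≤ ‖a₂‖ ^ 2) (ha₁ : 0 < ‖a₁‖) (ha₂ : 0 < ‖a₂‖)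
    (hsin : 0 < Real.sin (angle a₁ a₂)) (hlaw : ‖a₁ - a₂‖ = 2 * R * Real.sin (angle a₁ a₂))
    (hψ₀ : 0 < ψ) (hψ₁ : ψ ≤ π / 2) (hψ : ψ ≤ angle a₁ a₂) :
    L * ‖g‖ ≤ R * Real.cot (ψ / 2) := by
  set K := Real.cot (ψ / 2) with hK
  have hK1 : 1 ≤ K := one_le_cot_half hψ₀ hψ₁
  set α := angle a₁ a₂
  have hcos : Real.cos α ≤ Real.cos ψ :=
    Real.cos_le_cos_of_nonneg_of_le_pi hψ₀.le (angle_le_pi _ _) hψ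
  have hKα : 1 + Real.cos α ≤ K ^ 2 * (1 - Real.cos α) := by
    have := cot_half_sq_mul hψ₀ hψ₁
    rw [← hK] at this
    nlinarith [sq_nonneg K]
  have hC : inner ℝ a₁ a₂ = Real.cos α * (‖a₁‖ * ‖a₂‖) :=
    (cos_angle_mul_norm_mul_norm a₁ a₂).symm
  set A := ‖a₁‖
  set B := ‖a₂‖
  set x₁ := inner ℝ a₁ g with hx₁
  set x₂ := inner ℝ a₂ g with hx₂
  have e₁ : x₁ = c₁ * A ^ 2 + c₂ * (Real.cos α * (A * B)) := by
    rw [hx₁, hg, inner_add_right, inner_smul_right, inner_smul_right, real_inner_self_eq_norm_sq, hC]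
  have e₂ : x₂ = c₁ * (Real.cos α * (A * B)) + c₂ * B ^ 2 := by
    rw [hx₂, hg, inner_add_right, inner_smul_right, inner_smul_right, real_inner_self_eq_norm_sq,
      real_inner_comm, hC]
  have e₃ : ‖g‖ ^ 2 = c₁ * x₁ + c₂ * x₂ := by
    rw [← real_inner_self_eq_norm_sq]
    nth_rewrite 1 [hg]
    rw [inner_add_left, real_inner_smul_left, real_inner_smul_left]
  have hsc := Real.sin_sq_add_cos_sq α
  -- Cramer's rule: the norm of `g` in terms of its inner products with the basis `a₁, a₂`.
  have gram : ‖g‖ ^ 2 * (A ^ 2 * B ^ 2 * Real.sin α ^ 2) =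
      x₁ ^ 2 * B ^ 2 + x₂ ^ 2 * A ^ 2 - 2 * x₁ * x₂ * (Real.cos α * (A * B)) := by
    rw [e₃, e₁, e₂]
    linear_combination (A ^ 2 * B ^ 2 * (c₁ * (c₁ * A ^ 2 + c₂ * (Real.cos α * (A * B))) +
      c₂ * (c₁ * (Real.cos α * (A * B)) + c₂ * B ^ 2))) * hsc
  have b₁ : (2 * L) ^ 2 * x₁ ^ 2 ≤ A ^ 4 := by
    rw [← sq_abs x₁, ← mul_pow]
    calc (2 * L * |x₁|) ^ 2 ≤ (A ^ 2) ^ 2 := pow_le_pow_left₀ (by positivity) h₁ 2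
      _ = A ^ 4 := by ring
  have b₂ : (2 * L) ^ 2 * x₂ ^ 2 ≤ B ^ 4 := by
    rw [← sq_abs x₂, ← mul_pow]
    calc (2 * L * |x₂|) ^ 2 ≤ (B ^ 2) ^ 2 := pow_le_pow_left₀ (by positivity) h₂ 2
      _ = B ^ 4 := by ring
  have b₃ : -((2 * L) ^ 2 * (x₁ * x₂ * Real.cos α)) ≤ A ^ 2 * B ^ 2 * |Real.cos α| := by
    refine (neg_le_abs _).trans ?_
    rw [abs_mul, abs_mul, abs_mul, abs_of_pos (by positivity : 0 < (2 * L) ^ 2)]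
    have := mul_le_mul h₁ h₂ (by positivity) (by positivity)
    have := mul_le_mul_of_nonneg_right this (abs_nonneg (Real.cos α))
    linarith
  -- For an obtuse angle the two sides differ only by `K² ≥ 1`. For an acute one the ratio is
  -- largest at `A = B`, where it is `cot² (α/2) ≤ K²`.
  have hAB : A ^ 2 + B ^ 2 + 2 * (A * B * |Real.cos α|) ≤
      K ^ 2 * (A ^ 2 + B ^ 2 - 2 * (A * B * Real.cos α)) := by
    have hK2 : 1 ≤ K ^ 2 := one_le_pow₀ hK1
    have hm : 2 * (A * B) ≤ A ^ 2 + B ^ 2 := by linarith [sq_nonneg (A - B)]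
    have hABpos : 0 < A * B := mul_pos ha₁ ha₂
    rcases le_or_gt (Real.cos α) 0 with h | h
    · rw [abs_of_nonpos h]
      have h3 := mul_nonneg hABpos.le (neg_nonneg.2 h)
      have h4 : 0 ≤ A ^ 2 + B ^ 2 - 2 * (A * B * Real.cos α) := by
        linarith [sq_nonneg A, sq_nonneg B]
      have h5 := mul_nonneg (sub_nonneg.2 hK2) h4
      linarith
    · rw [abs_of_pos h]
      have h3 := mul_le_mul_of_nonneg_left hm (sub_nonneg.2 hK2)
      have h4 := mul_le_mul_of_nonneg_left hKα hABpos.le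
      linear_combination h3 + 2 * h4
  have hlaw2 : A ^ 2 + B ^ 2 - 2 * (A * B * Real.cos α) = (2 * R) ^ 2 * Real.sin α ^ 2 := by
    have : ‖a₁ - a₂‖ ^ 2 = (2 * R * Real.sin α) ^ 2 := by rw [hlaw]
    rw [norm_sub_sq_real, hC] at this
    linear_combination this
  have hfin : (2 * L) ^ 2 * ‖g‖ ^ 2 * (A ^ 2 * B ^ 2 * Real.sin α ^ 2) ≤
      K ^ 2 * (2 * R) ^ 2 * (A ^ 2 * B ^ 2 * Real.sin α ^ 2) := by
    have t₁ := mul_le_mul_of_nonneg_right b₁ (sq_nonneg B)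
    have t₂ := mul_le_mul_of_nonneg_right b₂ (sq_nonneg A)
    have t₃ := mul_le_mul_of_nonneg_left b₃ (by positivity : 0 ≤ 2 * (A * B))
    have t₄ := mul_le_mul_of_nonneg_left hAB (by positivity : 0 ≤ A ^ 2 * B ^ 2)
    rw [hlaw2] at t₄
    rw [mul_assoc ((2 * L) ^ 2), gram]
    linear_combination t₁ + t₂ + t₃ + t₄
  have hpos : 0 < A ^ 2 * B ^ 2 * Real.sin α ^ 2 := by positivity
  have := le_of_mul_le_mul_right hfin hpos
  have h5 : (L * ‖g‖) ^ 2 ≤ (R * K) ^ 2 := by linear_combination this / 4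
  exact abs_le_of_sq_le_sq' h5 (by positivity) |>.2

/-- A unit vector with a small component in `W` makes a small angle with its component in the
orthogonal complement of `W`. -/
theorem exists_mem_orthogonal_angle_le (W : Submodule ℝ E) [W.HasOrthogonalProjection] {n : E}
    (hn : ‖n‖ = 1) {β : ℝ} (hβ : ‖W.starProjection n‖ ≤ β) (hβ1 : β < 1) :
    ∃ z ∈ Wᗮ, z ≠ 0 ∧ angle n z ≤ Real.arcsin β := by
  set g := W.starProjection n with hg
  have hβ0 : 0 ≤ β := (norm_nonneg _).trans hβ
  have hz : n - g ∈ Wᗮ := W.sub_starProjection_mem_orthogonal n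
  have hgW : g ∈ W := W.starProjection_apply_mem n
  have hng : inner ℝ (n - g) g = 0 := Submodule.inner_left_of_mem_orthogonal hgW hz
  have h1 : inner ℝ n (n - g) = ‖n - g‖ ^ 2 := by
    have : n = (n - g) + g := by abel
    nth_rewrite 1 [this]
    rw [inner_add_left, real_inner_self_eq_norm_sq, real_inner_comm, hng, add_zero]
  have h2 : ‖n - g‖ ^ 2 = 1 - ‖g‖ ^ 2 := by
    have : ‖(n - g) + g‖ ^ 2 = ‖n - g‖ ^ 2 + 2 * inner ℝ (n - g) g + ‖g‖ ^ 2 := norm_add_sq_real _ _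
    rw [sub_add_cancel, hn, hng] at this
    linarith
  have h3 : ‖g‖ ^ 2 ≤ β ^ 2 := pow_le_pow_left₀ (norm_nonneg _) hβ 2
  have hpos : 0 < ‖n - g‖ := by
    by_contra hcon
    have : ‖n - g‖ = 0 := le_antisymm (not_lt.1 hcon) (norm_nonneg _)
    rw [this] at h2
    nlinarith
  refine ⟨n - g, hz, norm_pos_iff.1 hpos, ?_⟩
  rw [angle, h1, hn, one_mul, sq, mul_div_cancel_right₀ _ hpos.ne', Real.arcsin_eq_arccos hβ0]
  refine Real.arccos_le_arccos ?_
  rw [Real.sqrt_le_left (norm_nonneg _)]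
  linarith

end TriangleNormal

/-! ### Normal space of a triangle and its vertices -/

section Triangle

variable {d k : ℕ} {S : Set (EuclideanSpace ℝ (Fin d))}
  (τ : Affine.Triangle ℝ (EuclideanSpace ℝ (Fin d)))

/-- The circumcenter lies on both bisectors, so the direction of their intersection is the
intersection of their directions. -/
theorem direction_triangleNormalSpace :
    (triangleNormalSpace τ).direction = (vectorSpan ℝ (Set.range τ.points))ᗮ := by
  have h0 : τ.circumcenter ∈ AffineSubspace.perpBisector (τ.points 0) (τ.points 1) := by
    rw [AffineSubspace.mem_perpBisector_iff_dist_eq, τ.dist_circumcenter_eq_circumradius',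
      τ.dist_circumcenter_eq_circumradius']
  have h1 : τ.circumcenter ∈ AffineSubspace.perpBisector (τ.points 0) (τ.points 2) := by
    rw [AffineSubspace.mem_perpBisector_iff_dist_eq, τ.dist_circumcenter_eq_circumradius',
      τ.dist_circumcenter_eq_circumradius']
  rw [triangleNormalSpace, AffineSubspace.direction_inf_of_mem h0 h1,
    AffineSubspace.direction_perpBisector, AffineSubspace.direction_perpBisector,
    Submodule.inf_orthogonal, vectorSpan_range_eq_span_range_vsub_right ℝ τ.points 0]
  congr 1
  refine le_antisymm (sup_le ?_ ?_) (Submodule.span_le.2 ?_)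
  · exact Submodule.span_mono (by rintro _ rfl; exact ⟨1, rfl⟩)
  · exact Submodule.span_mono (by rintro _ rfl; exact ⟨2, rfl⟩)
  · rintro _ ⟨i, rfl⟩
    fin_cases i
    · simp
    · exact Submodule.mem_sup_left (Submodule.mem_span_singleton_self _)
    · exact Submodule.mem_sup_right (Submodule.mem_span_singleton_self _)

theorem finrank_direction_triangleNormalSpace :
    Module.finrank ℝ (triangleNormalSpace τ).direction + 2 = d := by
  have h1 := τ.independent.finrank_vectorSpan (n := 2) (by simp)
  have h2 := Submodule.finrank_add_finrank_orthogonal (vectorSpan ℝ (Set.range τ.points))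
  rw [direction_triangleNormalSpace]
  rw [h1, finrank_euclideanSpace_fin] at h2
  omega

variable {τ}

theorem not_collinear_of_ne {i j l : Fin 3} (hij : i ≠ j) (hil : i ≠ l) (hjl : j ≠ l) :
    ¬ Collinear ℝ {τ.points i, τ.points j, τ.points l} := by
  have := τ.independent
  exact (affineIndependent_iff_not_collinear_of_ne hij hil hjl).1 this

/-- **Triangle normal lemma**: normals of `S` at a vertex of a triangle have a small component in the
plane of the triangle. -/
theorem IsSubmanifold.lfs_mul_norm_starProjection_le (hS : IsSubmanifold k S) (hSc : IsCompact S)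
    (hτ : ∀ i, τ.points i ∈ S) {i j l : Fin 3} (hij : i ≠ j) (hil : i ≠ l) (hjl : j ≠ l)
    (hlfs : 0 < lfs S (τ.points i)) {n : EuclideanSpace ℝ (Fin d)}
    (hn : n ∈ (tangentDirection S (τ.points i))ᗮ) (hn1 : ‖n‖ = 1) {ψ : ℝ} (hψ₀ : 0 < ψ)
    (hψ₁ : ψ ≤ π / 2)
    (hψ : ψ ≤ EuclideanGeometry.angle (τ.points j) (τ.points i) (τ.points l)) :
    lfs S (τ.points i) * ‖(vectorSpan ℝ (Set.range τ.points)).starProjection n‖ ≤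
      τ.circumradius * Real.cot (ψ / 2) := by
  set W := vectorSpan ℝ (Set.range τ.points) with hW
  set v := τ.points i with hv
  set L := lfs S v with hLdef
  have hx : ∀ z ∈ S, 2 * L * |inner ℝ (z - v) n| ≤ ‖z - v‖ ^ 2 := by
    intro z hz
    have key : ∀ m ∈ (tangentDirection S v)ᗮ, ‖m‖ = 1 → 2 * L * inner ℝ (z - v) m ≤ ‖z - v‖ ^ 2 := by
      intro m hm hm1
      -- With `q = p = v` the exit length is the full feature size `L`.
      have := hS.exitLength_mul_inner_le hSc (p := v) (q := v) (hτ i)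
        (by rwa [sub_self, norm_zero]) hm hm1 hz
      simpa [exitLength, ← hLdef, Real.sqrt_sq hlfs.le] using this
    rcases abs_cases (inner ℝ (z - v) n) with ⟨h, -⟩ | ⟨h, -⟩
    · rw [h]; exact key n hn hn1
    · rw [h, ← inner_neg_right]
      exact key (-n) (Submodule.neg_mem _ hn) (by rwa [norm_neg])
  set a₁ := τ.points j - v with ha₁
  set a₂ := τ.points l - v with ha₂
  set g := W.starProjection n with hg
  have hgW : g ∈ W := Submodule.starProjection_apply_mem _ _
  have hinner : ∀ a ∈ W, inner ℝ a g = inner ℝ a n := by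
    intro a ha
    have : inner ℝ (n - g) a = 0 := Submodule.starProjection_inner_eq_zero _ _ ha
    rw [inner_sub_left] at this
    rw [real_inner_comm, real_inner_comm n a]
    linarith
  have hmem : ∀ m, τ.points m - v ∈ W := fun m =>
    vsub_mem_vectorSpan ℝ (Set.mem_range_self m) (Set.mem_range_self i)
  obtain ⟨c, hc⟩ : ∃ c : Fin 3 → ℝ, ∑ m, c m • (τ.points m - v) = g := by
    have h1 := hgW
    rw [hW, vectorSpan_range_eq_span_range_vsub_right ℝ τ.points i] at h1
    exact (Submodule.mem_span_range_iff_exists_fun ℝ).1 h1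
  have huniv : ∀ i j l : Fin 3, i ≠ j → i ≠ l → j ≠ l → (Finset.univ : Finset (Fin 3)) = {i, j, l} := by
    decide
  rw [huniv i j l hij hil hjl, Finset.sum_insert (by simp [hij, hil]), Finset.sum_pair hjl,
    ← hv, sub_self, smul_zero, zero_add] at hc
  have hinj := τ.independent.injective
  have hα : angle a₁ a₂ = EuclideanGeometry.angle (τ.points j) (τ.points i) (τ.points l) := rfl
  have hsin : 0 < Real.sin (angle a₁ a₂) := by
    rw [hα]
    exact EuclideanGeometry.sin_pos_of_not_collinear (not_collinear_of_ne hij.symm hjl hil)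
  have hlaw := τ.dist_div_sin_angle_eq_two_mul_circumradius hij.symm hjl hil
  rw [← hα, div_eq_iff hsin.ne', dist_eq_norm] at hlaw
  refine norm_le_of_abs_inner_le hc.symm hlfs τ.circumradius_pos ?_ ?_ ?_ ?_ hsin ?_ hψ₀ hψ₁
    (hα ▸ hψ)
  · rw [hinner _ (hmem j)]; exact hx _ (hτ j)
  · rw [hinner _ (hmem l)]; exact hx _ (hτ l)
  · exact norm_pos_iff.2 (sub_ne_zero.2 (hinj.ne hij.symm))
  · exact norm_pos_iff.2 (sub_ne_zero.2 (hinj.ne hil.symm))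
  · rw [← hlaw, sub_sub_sub_cancel_right]

end Triangle

/-! ### Distances from the nearest point to the vertices -/

section Distance

variable {d k : ℕ} {S : Set (EuclideanSpace ℝ (Fin d))} {x y v z : EuclideanSpace ℝ (Fin d)}

/-- The distance from the nearest point `y` of `x` to other points of `S`. -/
theorem sub_mul_dist_sq_le (hSc : IsCompact S) (hy : y ∈ S) (hnearest : ∀ z ∈ S, dist x y ≤ dist x z)
    (hv : dist x v < lfs S v) (hz : z ∈ S) :
    (lfs S v - dist x v) * dist z y ^ 2 ≤
      (dist z x ^ 2 - dist x y ^ 2) * (lfs S v - dist x v + dist x y) := by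
  rcases eq_or_ne x y with rfl | hxy
  · simp [mul_comm]
  set r := dist x y with hr
  have hrpos : 0 < r := dist_pos.2 hxy
  set n := r⁻¹ • (x - y) with hn
  have hxyn : x - y = r • n := by rw [hn, smul_smul, mul_inv_cancel₀ hrpos.ne', one_smul]
  have hn1 : ‖n‖ = 1 := by
    rw [hn, norm_smul, ← dist_eq_norm, ← hr, norm_inv, Real.norm_eq_abs, abs_of_pos hrpos,
      inv_mul_cancel₀ hrpos.ne']
  -- The ball around `x` touching at `y` grows with its center receding from `x` by up to `lfs S v -
  -- dist x v`, so the center stays within the feature size of `v`.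
  set t := lfs S v - dist x v + r with ht
  have htr : r < t := by linarith
  have hx : x = y + r • n := by rw [← hxyn]; abel
  have hball := disjoint_ball_of_forall_notMem_medialAxis hSc hy hn1 hrpos htr.le
    (by
      rw [← hx, disjoint_ball_iff_forall_le]
      intro w hw
      rw [dist_comm w x]
      exact hnearest w hw)
    (fun σ hσ hσt => by
      refine notMem_medialAxis_of_dist_lt (p := v) ?_
      have h1 : dist x (y + σ • n) = σ - r := by
        nth_rewrite 1 [hx]
        rw [dist_add_left, dist_eq_norm, ← sub_smul, norm_smul, hn1, mul_one, Real.norm_eq_abs,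
          abs_of_nonpos (by linarith)]
        ring
      have h2 := dist_triangle v x (y + σ • n)
      rw [dist_comm v x] at h2
      linarith)
  have h1 := pow_le_pow_left₀ (by linarith) (disjoint_ball_iff_forall_le.1 hball z hz) 2
  have h2 : ∀ s : ℝ, dist z (y + s • n) ^ 2 = dist z y ^ 2 - 2 * s * inner ℝ (z - y) n + s ^ 2 := by
    intro s
    rw [dist_eq_norm, dist_eq_norm, ← sub_sub, norm_sub_sq_real, inner_smul_right, norm_smul, hn1,
      Real.norm_eq_abs, mul_one, sq_abs]
    ring
  rw [h2] at h1
  have h3 := h2 r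
  rw [← hx] at h3
  have h4 : lfs S v - dist x v = t - r := by rw [ht]; ring
  rw [h3, h4]
  nlinarith

variable {τ : Affine.Triangle ℝ (EuclideanSpace ℝ (Fin d))}

theorem dist_points_le (i j : Fin 3) : dist (τ.points i) (τ.points j) ≤ 2 * τ.circumradius := by
  have h := dist_triangle_right (τ.points i) (τ.points j) τ.circumcenter
  rw [τ.dist_circumcenter_eq_circumradius, τ.dist_circumcenter_eq_circumradius] at h
  linarith

/-- Every point of a triangle is within the circumradius of some vertex. -/
theorem exists_dist_le_circumradius (hx : x ∈ convexHull ℝ (Set.range τ.points)) :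
    ∃ i, dist x (τ.points i) ≤ τ.circumradius := by
  by_contra! hcon
  set c := τ.circumcenter with hc
  -- If all vertices were farther from `x` than from the circumcenter, the triangle would lie
  -- strictly on the circumcenter's side of their bisector, and `x` does not.
  have hsub : Set.range τ.points ⊆
      {w | (-‖c - x‖ ^ 2 + 2 * inner ℝ (c - x) c) < (2 : ℝ) * inner ℝ (c - x) w} := by
    rintro _ ⟨i, rfl⟩
    rw [Set.mem_ofPred_eq]
    have h1 := pow_lt_pow_left₀ (hcon i) τ.circumradius_nonneg two_ne_zero
    rw [← τ.dist_circumcenter_eq_circumradius i, dist_comm x, dist_eq_norm, dist_eq_norm,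
      show τ.points i - x = (τ.points i - c) + (c - x) by abel, norm_add_sq_real,
      ← real_inner_comm, inner_sub_right] at h1
    linarith
  have hconv : Convex ℝ
      {w | (-‖c - x‖ ^ 2 + 2 * inner ℝ (c - x) c) < (2 : ℝ) * inner ℝ (c - x) w} := by
    refine convex_halfSpace_gt (f := fun w => (2 : ℝ) * inner ℝ (c - x) w) ⟨fun a b => ?_, fun s a => ?_⟩ _
    · rw [inner_add_right]; ring
    · rw [inner_smul_right, smul_eq_mul]; ring
  have h2 := convexHull_min hsub hconv hx
  rw [Set.mem_ofPred_eq] at h2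
  have h3 : inner ℝ (c - x) c - inner ℝ (c - x) x = ‖c - x‖ ^ 2 := by
    rw [← inner_sub_right, real_inner_self_eq_norm_sq]
  nlinarith [sq_nonneg ‖c - x‖]

/-- A bound for the distance to a vertex `l` of a triangle in terms of the distance to another
vertex `i`, if the side between `i` and the third vertex `j` is not shorter than the side opposite to
`i`. -/
theorem dist_sq_add_le {i j l : Fin 3} (hij : i ≠ j) (hil : i ≠ l) (hjl : j ≠ l)
    (hx : x ∈ convexHull ℝ (Set.range τ.points))
    (hside : dist (τ.points j) (τ.points l) ≤ dist (τ.points i) (τ.points j)) :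
    dist x (τ.points l) ^ 2 + 2 * τ.circumradius * dist x (τ.points i) ≤
      4 * τ.circumradius ^ 2 + dist x (τ.points i) ^ 2 := by
  set R := τ.circumradius with hR
  have hR0 : 0 ≤ R := τ.circumradius_nonneg
  set v := τ.points i with hv
  set w := τ.points l with hw
  -- The difference of the squared distances to `w` and `v` is affine, so the expression to be
  -- bounded is convex and it suffices to check the vertices.
  set f : EuclideanSpace ℝ (Fin d) → ℝ := fun y => 2 * inner ℝ (v - w) y + 2 * R * dist y v with hf
  have hfe : ∀ y, dist y w ^ 2 + 2 * R * dist y v - dist y v ^ 2 = f y + (‖w‖ ^ 2 - ‖v‖ ^ 2) := by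
    intro y
    have h : inner ℝ (v - w) y = inner ℝ y v - inner ℝ y w := by
      rw [inner_sub_left, real_inner_comm y v, real_inner_comm y w]
    simp only [hf, h]
    rw [dist_eq_norm y w, dist_eq_norm y v, norm_sub_sq_real, norm_sub_sq_real]
    ring
  have hfc : ConvexOn ℝ Set.univ f := by
    refine ConvexOn.add ?_ ((convexOn_dist v convex_univ).smul (by positivity : 0 ≤ 2 * R))
    refine ⟨convex_univ, fun a _ b _ s t _ _ _ => le_of_eq ?_⟩
    simp only [inner_add_right, inner_smul_right, smul_eq_mul]
    ring
  have hsub : Set.range τ.points ⊆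
      {y | y ∈ Set.univ ∧ f y ≤ 4 * R ^ 2 - (‖w‖ ^ 2 - ‖v‖ ^ 2)} := by
    rintro _ ⟨m, rfl⟩
    refine ⟨Set.mem_univ _, ?_⟩
    have hm := hfe (τ.points m)
    suffices h : dist (τ.points m) w ^ 2 + 2 * R * dist (τ.points m) v -
        dist (τ.points m) v ^ 2 ≤ 4 * R ^ 2 by linarith
    have hcases : ∀ i j l m : Fin 3, i ≠ j → i ≠ l → j ≠ l → m = i ∨ m = j ∨ m = l := by decide
    rcases hcases i j l m hij hil hjl with rfl | rfl | rfl
    · rw [← hv, dist_self]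
      have := pow_le_pow_left₀ dist_nonneg (dist_points_le (τ := τ) m l) 2
      rw [← hv, ← hw] at this
      linarith
    · have h1 := pow_le_pow_left₀ dist_nonneg hside 2
      have h2 := dist_points_le (τ := τ) m i
      rw [dist_comm v] at h1
      nlinarith
    · rw [← hw, dist_self]
      nlinarith [sq_nonneg (dist w v - R), sq_nonneg R]
  have h := convexHull_min hsub (hfc.convex_le _) hx
  have h2 := hfe x
  linarith [h.2]

/-- The inequality behind `dist y (τ.points l) ≤ 2R`. With `2` in place of `20 / 9` it fails, for
instance at `ρ = R`, `r = 2R / 3`; hence the separate treatment of `κ ≥ 9 / 20`. -/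
theorem dist_estimate_aux {R ρ r : ℝ} (hR : 0 < R) (hr : 0 ≤ r) (hrρ : r ≤ ρ) (hρ : ρ ≤ R) :
    r * (4 * R ^ 2 - 2 * R * ρ + ρ ^ 2 - r ^ 2) ≤
      (2 * R * ρ - ρ ^ 2 + r ^ 2) * (20 / 9 * R - ρ) := by
  rcases (hr.trans hrρ).eq_or_lt with h0 | hρ0
  · have : r = 0 := by linarith
    simp [this, ← h0]
  obtain ⟨q, rfl⟩ : ∃ q, r = ρ * q := ⟨r / ρ, by field_simp⟩
  obtain ⟨p, rfl⟩ : ∃ p, ρ = R * p := ⟨ρ / R, by field_simp⟩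
  have hp : 0 < p := pos_of_mul_pos_right hρ0 hR.le
  have hp1 : p ≤ 1 := le_of_mul_le_mul_left (by linarith) hR
  have hq : 0 ≤ q := nonneg_of_mul_nonneg_right hr hρ0
  have hq1 : q ≤ 1 := le_of_mul_le_mul_left (by linarith) hρ0
  have key : 0 ≤ (2 - p + q ^ 2 * p) * (20 / 9 - p) - q * (4 - 2 * p + p ^ 2 - q ^ 2 * p ^ 2) := by
    -- Expansion in powers of `1 - p`; the first bracket is the value at `p = 1`, written so that
    -- positivity near its minimum `q ≈ 2 / 3` is visible.
    have e : (2 - p + q ^ 2 * p) * (20 / 9 - p) - q * (4 - 2 * p + p ^ 2 - q ^ 2 * p ^ 2) =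
        ((q - 2 / 3) ^ 2 * (q + 23 / 9) + (7 - 3 * q) / 81) +
        (1 - p) * (2 * (1 - q) + (1 - q) * (1 + q) * (2 / 9 + 2 * q)) +
        (1 - p) ^ 2 * ((1 - q) * (1 + q) * (1 - q)) := by ring
    rw [e]
    have h1 : 0 ≤ 1 - q := by linarith
    have h2 : 0 ≤ 1 - p := by linarith
    have h3 : 0 ≤ 7 - 3 * q := by linarith
    positivity
  have : 0 ≤ R ^ 3 * p * ((2 - p + q ^ 2 * p) * (20 / 9 - p) -
      q * (4 - 2 * p + p ^ 2 - q ^ 2 * p ^ 2)) := by positivity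
  linarith

end Distance

/-! ### Angles between subspaces -/

section FlatAngle

variable {d : ℕ} {U W : Submodule ℝ (EuclideanSpace ℝ (Fin d))} {B : ℝ}

theorem lineAngle_le_angle (u v : EuclideanSpace ℝ (Fin d)) : lineAngle u v ≤ angle u v :=
  min_le_left _ _

theorem lineAngle_nonneg (u v : EuclideanSpace ℝ (Fin d)) : 0 ≤ lineAngle u v :=
  le_min (angle_nonneg _ _) (sub_nonneg.2 (angle_le_pi _ _))

theorem lineAngle_le_pi_div_two (u v : EuclideanSpace ℝ (Fin d)) : lineAngle u v ≤ π / 2 := by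
  rcases le_total (angle u v) (π / 2) with h | h
  · exact (min_le_left _ _).trans h
  · exact (min_le_right _ _).trans (by linarith)

theorem iInf_lineAngle_le {u w : EuclideanSpace ℝ (Fin d)} (hw : w ∈ W) (hw0 : w ≠ 0) :
    ⨅ w : {w : EuclideanSpace ℝ (Fin d) // w ∈ W ∧ w ≠ 0}, lineAngle u w.1 ≤ lineAngle u w :=
  ciInf_le (f := fun w : {w : EuclideanSpace ℝ (Fin d) // w ∈ W ∧ w ≠ 0} => lineAngle u w.1)
    ⟨0, by rintro _ ⟨i, rfl⟩; exact lineAngle_nonneg _ _⟩ ⟨w, hw, hw0⟩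

theorem maxMinAngle_le_pi_div_two : maxMinAngle U W ≤ π / 2 := by
  refine Real.iSup_le (fun u => ?_) (by positivity)
  rcases isEmpty_or_nonempty {w : EuclideanSpace ℝ (Fin d) // w ∈ W ∧ w ≠ 0} with h | h
  · rw [Real.iInf_of_isEmpty]; positivity
  · obtain ⟨w⟩ := h
    exact (iInf_lineAngle_le w.2.1 w.2.2).trans (lineAngle_le_pi_div_two _ _)

/-- The unit vectors of `U` make angles of at most `B`, up to arbitrarily small errors, with suitable
vectors of `W`. -/
def AnglesLE (U W : Submodule ℝ (EuclideanSpace ℝ (Fin d))) (B : ℝ) : Prop :=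
  ∀ u ∈ U, ‖u‖ = 1 → ∀ ε > 0, ∃ w ∈ W, w ≠ 0 ∧ angle u w ≤ B + ε

theorem AnglesLE.exists_of_ne_zero (h : AnglesLE U W B) {u : EuclideanSpace ℝ (Fin d)} (hu : u ∈ U)
    (hu0 : u ≠ 0) {ε : ℝ} (hε : 0 < ε) : ∃ w ∈ W, w ≠ 0 ∧ angle u w ≤ B + ε := by
  have hpos : 0 < ‖u‖⁻¹ := inv_pos.2 (norm_pos_iff.2 hu0)
  obtain ⟨w, hw, hw0, hang⟩ := h (‖u‖⁻¹ • u) (U.smul_mem _ hu)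
    (by rw [norm_smul, norm_inv, norm_norm, inv_mul_cancel₀ (norm_ne_zero_iff.2 hu0)]) ε hε
  rw [angle_smul_left_of_pos _ _ hpos] at hang
  exact ⟨w, hw, hw0, hang⟩

theorem AnglesLE.maxMinAngle_le (h : AnglesLE U W B) (hB : 0 ≤ B) : maxMinAngle U W ≤ B := by
  refine Real.iSup_le (fun u => ?_) hB
  refine le_of_forall_pos_le_add fun ε hε => ?_
  obtain ⟨w, hw, hw0, hang⟩ := h.exists_of_ne_zero u.2.1 u.2.2 hε
  exact (iInf_lineAngle_le hw hw0).trans ((lineAngle_le_angle _ _).trans hang)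

/-- The angle between subspaces of equal dimension is symmetric. -/
theorem AnglesLE.symm (h : AnglesLE U W B) (hB : B < π / 2)
    (hUW : Module.finrank ℝ U = Module.finrank ℝ W) : AnglesLE W U B := by
  set f : U →ₗ[ℝ] W := (W.orthogonalProjectionOnto : _ →ₗ[ℝ] W) ∘ₗ U.subtype with hf
  have hfv : ∀ u : U, (f u : EuclideanSpace ℝ (Fin d)) = W.starProjection u := fun u => rfl
  have hproj : ∀ u : U, ∀ w ∈ W, inner ℝ (u : EuclideanSpace ℝ (Fin d)) w =
      inner ℝ (f u : EuclideanSpace ℝ (Fin d)) w := by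
    intro u w hw
    have : inner ℝ ((u : EuclideanSpace ℝ (Fin d)) - W.starProjection u) w = 0 :=
      Submodule.starProjection_inner_eq_zero _ _ hw
    rw [inner_sub_left] at this
    rw [hfv]
    linarith
  have hinj : Function.Injective f := by
    rw [injective_iff_map_eq_zero]
    intro u hu
    by_contra hu0
    have hu0' : (u : EuclideanSpace ℝ (Fin d)) ≠ 0 := by simpa using hu0
    obtain ⟨w, hw, -, hang⟩ := h.exists_of_ne_zero u.2 hu0' (show 0 < (π / 2 - B) / 2 by linarith)
    have h0 : inner ℝ (u : EuclideanSpace ℝ (Fin d)) w = 0 := by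
      rw [hproj u w hw, hu]; simp
    rw [(inner_eq_zero_iff_angle_eq_pi_div_two _ _).1 h0] at hang
    linarith
  -- Angles below `π / 2` make the projection `U → W` injective, hence bijective. A preimage `u` of
  -- `w` makes with `w` the smallest angle that it makes with any vector of `W`.
  have hsurj := (LinearMap.injective_iff_surjective_of_finrank_eq_finrank hUW).1 hinj
  intro w hw hw1 ε hε
  obtain ⟨u, hu⟩ := hsurj ⟨w, hw⟩
  have hu' : (f u : EuclideanSpace ℝ (Fin d)) = w := by rw [hu]
  have hu0 : (u : EuclideanSpace ℝ (Fin d)) ≠ 0 := by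
    intro h0
    have : u = 0 := by simpa using h0
    rw [this, map_zero] at hu'
    rw [← hu'] at hw1
    simp at hw1
  obtain ⟨z, hz, hz0, hang⟩ := h.exists_of_ne_zero u.2 hu0 hε
  refine ⟨u, u.2, hu0, le_trans ?_ hang⟩
  have hupos := norm_pos_iff.2 hu0
  have hzpos := norm_pos_iff.2 hz0
  rw [angle_comm, angle, angle]
  refine Real.arccos_le_arccos ?_
  rw [hproj u w hw, hproj u z hz, hu', real_inner_self_eq_norm_sq, hw1,
    div_le_div_iff₀ (by positivity) (by positivity)]
  have := real_inner_le_norm w z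
  rw [hw1] at this
  nlinarith

theorem flatAngle_le_pi_div_two (F G : AffineSubspace ℝ (EuclideanSpace ℝ (Fin d))) :
    flatAngle F G ≤ π / 2 := by
  unfold flatAngle
  split_ifs <;> exact maxMinAngle_le_pi_div_two

/-- The definition takes the maximum over the smaller flat. Only for equal dimensions can it be the
wrong one, and there `AnglesLE.symm` applies. -/
theorem flatAngle_le {F G : AffineSubspace ℝ (EuclideanSpace ℝ (Fin d))}
    (h : AnglesLE G.direction F.direction B) (hB : 0 ≤ B) (hB' : B < π / 2)
    (hGF : Module.finrank ℝ G.direction ≤ Module.finrank ℝ F.direction) : flatAngle F G ≤ B := by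
  unfold flatAngle
  split_ifs with hle
  · exact (h.symm hB' (le_antisymm hGF hle)).maxMinAngle_le hB
  · exact h.maxMinAngle_le hB

end FlatAngle

/-! ### When the bound is trivial -/

section Bounds

theorem eta_nonneg (d k : ℕ) (δ : ℝ) : 0 ≤ eta d k δ := by
  unfold eta eta₁ eta₂
  split_ifs <;> first | exact Real.arccos_nonneg _ | positivity

theorem eta₁_le_eta {d k : ℕ} {δ : ℝ} (hδ : δ < 1) (h : eta d k δ < π / 2) :
    eta₁ δ ≤ eta d k δ := by
  unfold eta at h ⊢
  split_ifs at h ⊢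
  · exact le_rfl
  · exact eta₁_le_eta₂ hδ h

theorem pi_div_two_le_eta {d k : ℕ} {δ : ℝ} (hδ : 1 ≤ δ) : π / 2 ≤ eta d k δ := by
  unfold eta eta₁ eta₂
  have := Real.pi_pos
  split_ifs <;> linarith

/-- For large `κ` the bound exceeds a right angle. -/
theorem pi_div_two_le_eta_add_arcsin {d k : ℕ} {κ β : ℝ} (hκ : 9 / 20 ≤ κ) (hβ : κ ≤ β) :
    π / 2 ≤ eta d k (2 * κ) + Real.arcsin β := by
  have hβ0 : 0 ≤ Real.arcsin β := Real.arcsin_nonneg.2 (by linarith)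
  rcases le_or_gt (π / 2) (eta d k (2 * κ)) with h | h
  · linarith
  have hδ : 2 * κ < 1 := by
    by_contra hcon
    exact not_le.2 h (pi_div_two_le_eta (not_lt.1 hcon))
  have h1 := eta₁_le_eta hδ h
  rw [eta₁, if_pos hδ, Real.arccos_eq_pi_div_two_sub_arcsin] at h1
  have hs : 0 < √(1 - (2 * κ) ^ 2) := Real.sqrt_pos.2 (by nlinarith)
  have hs' : √(1 - (2 * κ) ^ 2) ≤ 1 / 2 := by
    rw [Real.sqrt_le_left (by norm_num)]
    nlinarith
  -- So `1 - X ≤ 19 / 100`, which is below `κ ≤ β`; thus `arcsin β` makes up what `eta₁` lacks to a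
  -- right angle.
  have hX : 81 / 100 ≤ (2 * κ) ^ 2 / (2 * √(1 - (2 * κ) ^ 2)) := by
    rw [le_div_iff₀ (by positivity)]
    nlinarith
  have h2 : Real.arcsin (1 - (2 * κ) ^ 2 / (2 * √(1 - (2 * κ) ^ 2))) ≤ Real.arcsin β :=
    Real.monotone_arcsin (by linarith)
  linarith

end Bounds

/-! ### Choice of the vertex -/

section Main

variable {d k : ℕ} {S : Set (EuclideanSpace ℝ (Fin d))}
  {τ : Affine.Triangle ℝ (EuclideanSpace ℝ (Fin d))}

/-- The bound for the angle between the normals at `y` and those of a triangle, obtained by going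
through the normals at the vertex `i`. -/
theorem IsSubmanifold.anglesLE_of_vertex (hS : IsSubmanifold k S) (hSc : IsCompact S)
    (hτ : ∀ i, τ.points i ∈ S) {i j l : Fin 3} (hij : i ≠ j) (hil : i ≠ l) (hjl : j ≠ l)
    {κ δ ψ : ℝ} {y : EuclideanSpace ℝ (Fin d)} (hy : y ∈ S) (hlfs : 0 < lfs S (τ.points i))
    (hR : τ.circumradius ≤ κ * lfs S (τ.points i)) (hδ : δ < 1)
    (hyi : dist y (τ.points i) ≤ δ * lfs S (τ.points i)) (hψ₀ : 0 < ψ) (hψ₁ : ψ ≤ π / 2)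
    (hψ : ψ ≤ EuclideanGeometry.angle (τ.points j) (τ.points i) (τ.points l))
    (hB : eta d k δ + Real.arcsin (κ * Real.cot (ψ / 2)) < π / 2) :
    AnglesLE (tangentDirection S y)ᗮ (vectorSpan ℝ (Set.range τ.points))ᗮ
      (eta d k δ + Real.arcsin (κ * Real.cot (ψ / 2))) := by
  set L := lfs S (τ.points i) with hL
  set W := vectorSpan ℝ (Set.range τ.points)
  have hcot : 0 ≤ Real.cot (ψ / 2) := zero_le_one.trans (one_le_cot_half hψ₀ hψ₁)
  have hκ : 0 ≤ κ := by
    by_contra hcon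
    have := τ.circumradius_nonneg
    nlinarith [mul_neg_of_neg_of_pos (not_le.1 hcon) hlfs, τ.circumradius_pos]
  have hβ0 : 0 ≤ Real.arcsin (κ * Real.cot (ψ / 2)) := Real.arcsin_nonneg.2 (by positivity)
  have heta := eta_nonneg d k δ
  have hβ1 : κ * Real.cot (ψ / 2) < 1 := Real.arcsin_lt_pi_div_two.1 (by linarith)
  have hσ : ‖y - τ.points i‖ / L ≤ δ := by
    rw [div_le_iff₀ hlfs, ← dist_eq_norm]; exact hyi
  have hσ0 : 0 ≤ ‖y - τ.points i‖ / L := by positivity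
  have hetaσ : eta₁ (‖y - τ.points i‖ / L) ≤ eta d k δ :=
    (eta₁_le_eta₁ hσ0 hσ hδ).trans (eta₁_le_eta hδ (by linarith))
  intro n hn hn1 ε hε
  obtain ⟨m, hm, hm1, hnm⟩ := hS.exists_angle_le_eta₁ hSc (hτ i) hy
    ((div_lt_one hlfs).1 (hσ.trans_lt hδ)) (by linarith [Real.pi_pos]) hn hn1 hε
  have hW : ‖W.starProjection m‖ ≤ κ * Real.cot (ψ / 2) := by
    have h1 := hS.lfs_mul_norm_starProjection_le hSc hτ hij hil hjl hlfs hm hm1 hψ₀ hψ₁ hψ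
    have h2 := mul_le_mul_of_nonneg_right hR hcot
    refine le_of_mul_le_mul_left ?_ hlfs
    linarith
  obtain ⟨z, hz, hz0, hmz⟩ := exists_mem_orthogonal_angle_le W hm1 hW hβ1
  exact ⟨z, hz, hz0, by linarith [angle_le_angle_add_angle n m z]⟩

theorem exists_ne_of_fin_three (i : Fin 3) : ∃ j l : Fin 3, i ≠ j ∧ i ≠ l ∧ j ≠ l := by
  revert i; decide

/-- The bound through the nearest vertex, or through the vertex with the larger angle. -/
theorem IsSubmanifold.anglesLE_max (hS : IsSubmanifold k S) (hSc : IsCompact S)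
    (hτ : ∀ i, τ.points i ∈ S) {κ : ℝ} (hκ : κ ≤ 1 / 2)
    (hR : ∀ i, τ.circumradius ≤ κ * lfs S (τ.points i)) {x y : EuclideanSpace ℝ (Fin d)}
    (hx : x ∈ convexHull ℝ (Set.range τ.points)) (hy : y ∈ S)
    (hnearest : ∀ z ∈ S, dist x y ≤ dist x z) {φ : ℝ} (hφ : φ ∈ Set.Ioc 0 (π / 3)) :
    (∃ B, 0 ≤ B ∧ B < π / 2 ∧
      B ≤ max (eta d k (√2 * κ) + Real.arcsin (κ * Real.cot (φ / 2)))
        (eta d k (2 * κ) + Real.arcsin (κ * Real.cot (π / 4 - φ / 4))) ∧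
      AnglesLE (tangentDirection S y)ᗮ (vectorSpan ℝ (Set.range τ.points))ᗮ B) ∨
    π / 2 ≤ max (eta d k (√2 * κ) + Real.arcsin (κ * Real.cot (φ / 2)))
        (eta d k (2 * κ) + Real.arcsin (κ * Real.cot (π / 4 - φ / 4))) := by
  have hπ := Real.pi_pos
  obtain ⟨hφ0, hφ1⟩ := hφ
  set R := τ.circumradius with hRdef
  have hRpos : 0 < R := τ.circumradius_pos
  have hprod : ∀ i, 0 < κ * lfs S (τ.points i) := fun i => hRpos.trans_le (hR i)
  have hlfs0 : ∀ i, 0 ≤ lfs S (τ.points i) := fun i => infDist_nonneg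
  -- The positive circumradius excludes `lfs = 0`, also the default value for an empty medial axis.
  have hlfs : ∀ i, 0 < lfs S (τ.points i) := fun i =>
    (hlfs0 i).lt_of_ne fun h => by have := hprod i; rw [← h, mul_zero] at this; exact lt_irrefl _ this
  have hκ0 : 0 < κ := pos_of_mul_pos_left (hprod 0) (hlfs0 0)
  have hL2 : ∀ i, 2 * R ≤ lfs S (τ.points i) := fun i => by
    have := mul_le_mul_of_nonneg_right hκ (hlfs0 i)
    linarith [hR i]
  refine or_iff_not_imp_right.2 fun hlt => ?_
  obtain ⟨hlt₁, hlt₂⟩ := max_lt_iff.1 (not_le.1 hlt)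
  -- the vertex nearest to `x`
  obtain ⟨i, -, hi⟩ := Finset.exists_min_image Finset.univ (fun i => dist x (τ.points i))
    ⟨0, Finset.mem_univ _⟩
  have hi : ∀ j, dist x (τ.points i) ≤ dist x (τ.points j) := fun j => hi j (Finset.mem_univ _)
  set ρ := dist x (τ.points i) with hρ
  set r := dist x y with hr
  have hr0 : 0 ≤ r := dist_nonneg
  have hrρ : r ≤ ρ := hnearest _ (hτ i)
  have hρR : ρ ≤ R := by
    obtain ⟨j, hj⟩ := exists_dist_le_circumradius hx
    exact (hi j).trans hj
  have hLi := hL2 i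
  have hest : ∀ z ∈ S, (lfs S (τ.points i) - ρ) * dist z y ^ 2 ≤
      (dist z x ^ 2 - r ^ 2) * (lfs S (τ.points i) - ρ + r) := fun z hz =>
    sub_mul_dist_sq_le hSc hy hnearest (by linarith) hz
  set G := lfs S (τ.points i) - ρ with hG
  have hGρ : ρ ≤ G := by linarith
  have hGpos : 0 < G := by linarith
  have harcsin : ∀ ψ, 0 < ψ → ψ ≤ π / 2 → 0 ≤ Real.arcsin (κ * Real.cot (ψ / 2)) :=
    fun ψ h0 h1 => Real.arcsin_nonneg.2
      (mul_nonneg hκ0.le (zero_le_one.trans (one_le_cot_half h0 h1)))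
  obtain ⟨j, l, hij, hil, hjl⟩ := exists_ne_of_fin_three i
  rcases le_or_gt φ (EuclideanGeometry.angle (τ.points j) (τ.points i) (τ.points l)) with hang | hang
  · have hdist : dist y (τ.points i) ≤ √2 * κ * lfs S (τ.points i) := by
      have h1 := hest _ (hτ i)
      rw [dist_comm _ x, ← hρ] at h1
      -- The factor `2` arises from `G + r ≤ 2G`, as `r ≤ ρ ≤ G`.
      have h2 : dist (τ.points i) y ^ 2 ≤ 2 * R ^ 2 := by
        refine le_of_mul_le_mul_left (h1.trans ?_) hGpos
        have h3 : (ρ ^ 2 - r ^ 2) * (G + r) ≤ ρ ^ 2 * (2 * G) :=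
          mul_le_mul (by nlinarith) (by linarith) (by linarith) (sq_nonneg _)
        have h4 : ρ ^ 2 ≤ R ^ 2 := pow_le_pow_left₀ (hr0.trans hrρ) hρR 2
        nlinarith
      have h3 : dist (τ.points i) y ≤ √2 * R := by
        refine abs_le_of_sq_le_sq' ?_ (by positivity) |>.2
        rw [mul_pow, Real.sq_sqrt (by norm_num)]
        exact h2
      rw [dist_comm]
      have := mul_le_mul_of_nonneg_left (hR i) (Real.sqrt_nonneg 2)
      linarith
    have hδ : √2 * κ < 1 := by
      have : √2 < 2 := by
        rw [Real.sqrt_lt' (by norm_num)]; norm_num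
      nlinarith
    exact ⟨_, add_nonneg (eta_nonneg _ _ _) (harcsin φ hφ0 (by linarith)), hlt₁, le_max_left _ _,
      hS.anglesLE_of_vertex hSc hτ hij hil hjl hy (hlfs i) (hR i) hδ hdist hφ0 (by linarith) hang
        hlt₁⟩
  · -- the vertex `l` has the larger one of the other two angles
    obtain ⟨j, l, hij, hil, hjl, hang, hjl'⟩ : ∃ j l : Fin 3, i ≠ j ∧ i ≠ l ∧ j ≠ l ∧
        EuclideanGeometry.angle (τ.points j) (τ.points i) (τ.points l) < φ ∧
        EuclideanGeometry.angle (τ.points i) (τ.points j) (τ.points l) ≤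
          EuclideanGeometry.angle (τ.points j) (τ.points l) (τ.points i) := by
      rcases le_total (EuclideanGeometry.angle (τ.points i) (τ.points j) (τ.points l))
        (EuclideanGeometry.angle (τ.points j) (τ.points l) (τ.points i)) with h | h
      · exact ⟨j, l, hij, hil, hjl, hang, h⟩
      · refine ⟨l, j, hil, hij, hjl.symm, ?_, ?_⟩
        · rwa [EuclideanGeometry.angle_comm]
        · rwa [EuclideanGeometry.angle_comm, EuclideanGeometry.angle_comm (τ.points l)]
    have hinj := τ.independent.injective
    have hsum := EuclideanGeometry.angle_add_angle_add_angle_eq_pi (p₁ := τ.points i)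
      (p₂ := τ.points j) (τ.points l) (hinj.ne hij.symm)
    rw [EuclideanGeometry.angle_comm (τ.points l) (τ.points i) (τ.points j)] at hsum
    have hψ : π / 2 - φ / 2 ≤
        EuclideanGeometry.angle (τ.points j) (τ.points l) (τ.points i) := by linarith
    -- As `φ ≤ π / 3`, the angle at `i` is below `φ ≤ π / 2 - φ / 2`, hence smaller than the one at
    -- `l`; the larger angle faces the longer side.
    have hside : dist (τ.points j) (τ.points l) ≤ dist (τ.points i) (τ.points j) := by
      rw [dist_comm (τ.points i)]
      refine (EuclideanGeometry.angle_le_iff_dist_le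
        (not_collinear_of_ne hjl hij.symm hil.symm)).1 ?_
      linarith
    have hcot : Real.cot (π / 4 - φ / 4) = Real.cot ((π / 2 - φ / 2) / 2) := by congr 1; ring
    rw [hcot] at hlt₂ ⊢
    have hψ0 : 0 < π / 2 - φ / 2 := by linarith
    have hψ1 : π / 2 - φ / 2 ≤ π / 2 := by linarith
    have hκ' : κ < 9 / 20 := by
      by_contra hcon
      refine not_le.2 hlt₂ (pi_div_two_le_eta_add_arcsin (not_lt.1 hcon) ?_)
      exact le_mul_of_one_le_right hκ0.le (one_le_cot_half hψ0 hψ1)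
    have hLi' : 20 / 9 * R ≤ lfs S (τ.points i) := by
      have := mul_le_mul_of_nonneg_right hκ'.le (hlfs0 i)
      linarith [hR i]
    have hdist : dist y (τ.points l) ≤ 2 * κ * lfs S (τ.points l) := by
      have h1 := hest _ (hτ l)
      rw [dist_comm _ x] at h1
      have h2 := dist_sq_add_le hij hil hjl hx hside
      rw [← hρ, ← hRdef] at h2
      have h3 := dist_estimate_aux hRpos hr0 hrρ hρR
      -- The feature size at `i`, not at `l`, is used here, since `x` is close to `i`; what is
      -- needed is `P * r ≤ (4R² - P) * G`.
      have h4 : dist (τ.points l) y ^ 2 ≤ 4 * R ^ 2 := by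
        refine le_of_mul_le_mul_left (h1.trans ?_) hGpos
        set P := dist x (τ.points l) ^ 2 - r ^ 2 with hP
        have h5 : P ≤ 4 * R ^ 2 - 2 * R * ρ + ρ ^ 2 - r ^ 2 := by linarith
        have h6 : P * r ≤ r * (4 * R ^ 2 - 2 * R * ρ + ρ ^ 2 - r ^ 2) := by
          rw [mul_comm]; exact mul_le_mul_of_nonneg_left h5 hr0
        have h7 : 0 ≤ 2 * R * ρ - ρ ^ 2 + r ^ 2 := by nlinarith
        have h8 : (2 * R * ρ - ρ ^ 2 + r ^ 2) * (20 / 9 * R - ρ) ≤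
            (2 * R * ρ - ρ ^ 2 + r ^ 2) * G := mul_le_mul_of_nonneg_left (by linarith) h7
        have h9 : (2 * R * ρ - ρ ^ 2 + r ^ 2) * G ≤ (4 * R ^ 2 - P) * G :=
          mul_le_mul_of_nonneg_right (by linarith) hGpos.le
        linarith
      have h5 : dist (τ.points l) y ≤ 2 * R :=
        abs_le_of_sq_le_sq' (by linarith) (by positivity) |>.2
      rw [dist_comm]
      linarith [hR l]
    exact ⟨_, add_nonneg (eta_nonneg _ _ _) (harcsin _ hψ0 hψ1), hlt₂, le_max_right _ _,
      hS.anglesLE_of_vertex hSc hτ hjl.symm hil.symm hij.symm hy (hlfs l) (hR l) (by linarith) hdist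
        hψ0 hψ1 hψ hlt₂⟩

end Main

end

theorem lemma9 (d k : ℕ) (hk : 2 ≤ k) (hkd : k < d)
    (S : Set (EuclideanSpace ℝ (Fin d))) (hS : IsSubmanifold k S) (hcompact : IsCompact S)
    (τ : Affine.Triangle ℝ (EuclideanSpace ℝ (Fin d))) (hτ : ∀ i, τ.points i ∈ S)
    (κ : ℝ) (hκ : κ ≤ 1 / 2) (hR : ∀ i, τ.circumradius ≤ κ * lfs S (τ.points i))
    (x : EuclideanSpace ℝ (Fin d)) (hx : x ∈ convexHull ℝ (Set.range τ.points))
    (y : EuclideanSpace ℝ (Fin d)) (hy : y ∈ S) (hnearest : ∀ z ∈ S, dist x y ≤ dist x z)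
    (φ : ℝ) (hφ : φ ∈ Set.Ioc 0 (π / 3)) :
    flatAngle (triangleNormalSpace τ) (normalSpace S y) ≤
      max (eta d k (√2 * κ) + Real.arcsin (κ * Real.cot (φ / 2)))
        (eta d k (2 * κ) + Real.arcsin (κ * Real.cot (π / 4 - φ / 4))) := by
  rcases hS.anglesLE_max hcompact hτ hκ hR hx hy hnearest hφ with ⟨B, hB0, hB1, hBle, hB⟩ | h
  · refine (flatAngle_le (B := B) ?_ hB0 hB1 ?_).trans hBle
    · rw [direction_triangleNormalSpace, normalSpace, AffineSubspace.direction_mk']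
      exact hB
    · have h1 := finrank_direction_triangleNormalSpace τ
      have h2 := (tangentDirection S y).finrank_add_finrank_orthogonal
      rw [hS.finrank_tangentDirection hy, finrank_euclideanSpace_fin] at h2
      rw [normalSpace, AffineSubspace.direction_mk']
      omega
  · exact (flatAngle_le_pi_div_two _ _).trans h
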